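/- Let $\mathbb{X}=\{0,1\}^{\mathbb{N}}$ with the left shift $\sigma$ and the metric $d(x,y)=2^{-k+1}$ for $x\neq y$, where $k\ge 1$ is the smallest index with $x_k\neq y_k$. For $x\in\mathbb{X}$ and $n\in\mathbb{N}$ let $C_n(x)=\{y\in\mathbb{X}: y_1\cdots y_n=x_1\cdots x_n\}$, and let $\pi_2(x)=\sum_{n\ge 1}x_n2^{-n}\in\mathbb{T}=\mathbb{R}/\mathbb{Z}$. Let $\mu_{\mathrm{TM}}$ be the Thue--Morse measure on $\mathbb{T}$, that is, the weak limit, as $n\to\infty$, of the probability measures with Lebesgue densities $\prod_{m=0}^{n-1}\bigl(1-\cos(2\pi 2^m x)\bigr)$, and let $\mu$ be its lift to $\mathbb{X}$, that is, the unique Borel measure on $\mathbb{X}$ with $\mu\circ\pi_2^{-1}=\mu_{\mathrm{TM}}$. Let $\psi\colon\mathbb{X}\to[-\infty,0]$, $\psi(x)=\log\frac{1-\cos(2\pi\,\pi_2(x))}{2}$ (with $\log 0=-\infty$), and $S_n\psi(x)=\sum_{m=0}^{n-1}\psi(\sigma^m x)$. **Theorem.** For each $\gamma\in(1,2)$ and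 each real $\alpha\ge 0$, both level sets $$\Bigl\{x\in\mathbb{X}:\ \lim_{n\to\infty}\frac{\log\mu(C_n(x))}{-n^{\gamma}\log 2}=\alpha\Bigr\},\qquad \Bigl\{x\in\mathbb{X}:\ \lim_{n\to\infty}\frac{-S_n\psi(x)}{n^{\gamma}\log 2}=\alpha\Bigr\}$$ have Hausdorff dimension $1$ (with respect to $d$). -/

import Mathlib

open MeasureTheory Filter Topology
open scoped ENNReal

noncomputable section

/-- The function `x ↦ 1 - cos (2πx)` on the torus `ℝ/ℤ`. -/
def oneSubCos : UnitAddCircle → ℝ :=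
  Function.Periodic.lift (f := fun x : ℝ => 1 - Real.cos (2 * Real.pi * x)) (c := 1) (by
    intro x
    simp only
    rw [mul_add, mul_one, Real.cos_add_two_pi])

theorem oneSubCos_coe (x : ℝ) :
    oneSubCos (x : UnitAddCircle) = 1 - Real.cos (2 * Real.pi * x) := rfl

theorem oneSubCos_eq_fourier (x : UnitAddCircle) :
    (oneSubCos x : ℂ) = 1 - (fourier 1 x + fourier (-1) x) / 2 := by
  induction x using QuotientAddGroup.induction_on with
  | H x =>
    rw [oneSubCos_coe, fourier_coe_apply, fourier_coe_apply]
    push_cast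
    rw [Complex.cos]
    ring_nf

theorem oneSubCos_eq_re (x : UnitAddCircle) : oneSubCos x = 1 - (fourier 1 x).re := by
  have h := congrArg Complex.re (oneSubCos_eq_fourier x)
  rw [fourier_neg] at h
  simp only [Complex.ofReal_re, Complex.sub_re, Complex.one_re, Complex.add_conj] at h
  rw [h]
  congr 1
  norm_cast
  simp

theorem continuous_oneSubCos : Continuous oneSubCos := by
  have : oneSubCos = fun x => 1 - (fourier 1 x).re := funext oneSubCos_eq_re
  rw [this]
  fun_prop

theorem oneSubCos_nonneg (x : UnitAddCircle) : 0 ≤ oneSubCos x := by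
  induction x using QuotientAddGroup.induction_on with
  | H x =>
    rw [oneSubCos_coe]
    linarith [Real.cos_le_one (2 * Real.pi * x)]

/-- The partial Riesz product `∏_{m < n} (1 - cos (2π 2^m x))`. -/
def rieszProduct (n : ℕ) (x : UnitAddCircle) : ℝ :=
  ∏ m ∈ Finset.range n, oneSubCos (2 ^ m • x)

theorem continuous_rieszProduct (n : ℕ) : Continuous (rieszProduct n) := by
  unfold rieszProduct
  exact continuous_finsetProd _ fun m _ => continuous_oneSubCos.comp (continuous_nsmul _)

theorem rieszProduct_nonneg (n : ℕ) (x : UnitAddCircle) : 0 ≤ rieszProduct n x :=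
  Finset.prod_nonneg fun _ _ => oneSubCos_nonneg _

theorem rieszProduct_succ (n : ℕ) (x : UnitAddCircle) :
    rieszProduct (n + 1) x = oneSubCos x * rieszProduct n (2 • x) := by
  unfold rieszProduct
  rw [Finset.prod_range_succ', mul_comm]
  simp only [pow_zero, one_smul, pow_succ, mul_smul]

/-- Fourier coefficients of the partial Riesz products. -/
def rieszCoeff (n : ℕ) (k : ℤ) : ℂ := ∫ x : UnitAddCircle, fourier k x * (rieszProduct n x : ℂ)

theorem integrable_of_continuous_unitAddCircle {f : UnitAddCircle → ℂ} (hf : Continuous f) :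
    Integrable f :=
  hf.integrable_of_hasCompactSupport (HasCompactSupport.of_compactSpace f)

theorem integral_fourier_double_even (n : ℕ) (j : ℤ) :
    ∫ x : UnitAddCircle, fourier (2 * j) x * (rieszProduct n (2 • x) : ℂ) = rieszCoeff n j := by
  have hmp : MeasurePreserving (fun y : UnitAddCircle => 2 • y) volume volume :=
    (AddCircle.ergodic_nsmul (T := 1) (n := 2) (by norm_num)).toMeasurePreserving
  unfold rieszCoeff
  have hc : Continuous fun x : UnitAddCircle => fourier j x * (rieszProduct n x : ℂ) :=
    (fourier j).continuous.mul (Complex.continuous_ofReal.comp (continuous_rieszProduct n))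
  rw [← hmp.map_eq, integral_map hmp.measurable.aemeasurable
    hc.aestronglyMeasurable, hmp.map_eq]
  refine integral_congr_ae (Eventually.of_forall fun x => ?_)
  simp only [fourier_apply]
  congr 3
  rw [mul_comm, mul_smul]
  rfl

theorem integral_fourier_double_odd (n : ℕ) (j : ℤ) :
    ∫ x : UnitAddCircle, fourier (2 * j + 1) x * (rieszProduct n (2 • x) : ℂ) = 0 := by
  set h : UnitAddCircle := ((1 / 2 : ℝ) : UnitAddCircle) with hh
  have h2 : 2 • h = 0 := by
    rw [hh, ← AddCircle.coe_nsmul]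
    norm_num
  have hf : fourier (2 * j + 1) h = (-1 : ℂ) := by
    rw [hh, fourier_coe_apply]
    have : 2 * (Real.pi : ℂ) * Complex.I * ((2 * j + 1 : ℤ) : ℂ) * ((1 / 2 : ℝ) : ℂ) / ((1 : ℝ) : ℂ)
        = (Real.pi : ℂ) * Complex.I + j * (2 * Real.pi * Complex.I) := by
      push_cast
      ring
    rw [this, Complex.exp_add, Complex.exp_int_mul_two_pi_mul_I, Complex.exp_pi_mul_I, mul_one]
  have key : ∀ x : UnitAddCircle,
      fourier (2 * j + 1) (x + h) * (rieszProduct n (2 • (x + h)) : ℂ)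
        = -(fourier (2 * j + 1) x * (rieszProduct n (2 • x) : ℂ)) := by
    intro x
    rw [smul_add, h2, add_zero]
    have : (fourier (2 * j + 1) (x + h) : ℂ)
        = fourier (2 * j + 1) x * fourier (2 * j + 1) h := by
      simp [fourier_apply, smul_add, AddCircle.toCircle_add]
    rw [this, hf]
    ring
  have e := integral_add_right_eq_self (μ := (volume : Measure UnitAddCircle))
    (fun x => fourier (2 * j + 1) x * (rieszProduct n (2 • x) : ℂ)) h
  simp only [key, integral_neg] at e
  exact self_eq_neg.mp e.symm

theorem rieszCoeff_succ (n : ℕ) (k : ℤ) :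
    rieszCoeff (n + 1) k =
      (∫ x : UnitAddCircle, fourier k x * (rieszProduct n (2 • x) : ℂ))
      - ((∫ x : UnitAddCircle, fourier (k + 1) x * (rieszProduct n (2 • x) : ℂ))
        + ∫ x : UnitAddCircle, fourier (k - 1) x * (rieszProduct n (2 • x) : ℂ)) / 2 := by
  have hint : ∀ l : ℤ, Integrable
      (fun x : UnitAddCircle => fourier l x * (rieszProduct n (2 • x) : ℂ)) := fun l =>
    integrable_of_continuous_unitAddCircle ((fourier l).continuous.mul
      (Complex.continuous_ofReal.comp ((continuous_rieszProduct n).comp (continuous_nsmul 2))))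
  have hint2 : Integrable (fun x : UnitAddCircle =>
      (fourier (k + 1) x * (rieszProduct n (2 • x) : ℂ)
        + fourier (k - 1) x * (rieszProduct n (2 • x) : ℂ)) / 2) :=
    ((hint _).add (hint _)).div_const 2
  rw [← integral_add (hint _) (hint _), ← integral_div, ← integral_sub (hint _) hint2]
  unfold rieszCoeff
  refine integral_congr_ae (Eventually.of_forall fun x => ?_)
  simp only [rieszProduct_succ, Complex.ofReal_mul, oneSubCos_eq_fourier,
    fourier_add, sub_eq_add_neg]
  ring

theorem rieszCoeff_succ_even (n : ℕ) (j : ℤ) : rieszCoeff (n + 1) (2 * j) = rieszCoeff n j := by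
  rw [rieszCoeff_succ, integral_fourier_double_even, integral_fourier_double_odd,
    show 2 * j - 1 = 2 * (j - 1) + 1 by ring, integral_fourier_double_odd]
  simp

theorem rieszCoeff_succ_odd (n : ℕ) (j : ℤ) :
    rieszCoeff (n + 1) (2 * j + 1) = -(rieszCoeff n (j + 1) + rieszCoeff n j) / 2 := by
  rw [rieszCoeff_succ, integral_fourier_double_odd,
    show 2 * j + 1 + 1 = 2 * (j + 1) by ring, integral_fourier_double_even,
    show 2 * j + 1 - 1 = 2 * j by ring, integral_fourier_double_even]
  ring

theorem rieszCoeff_zero (n : ℕ) : rieszCoeff n 0 = 1 := by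
  induction n with
  | zero => simp [rieszCoeff, rieszProduct, Measure.real]
  | succ n ih => rw [← ih, ← rieszCoeff_succ_even n 0, mul_zero]

theorem lintegral_rieszProduct (n : ℕ) :
    ∫⁻ x : UnitAddCircle, ENNReal.ofReal (rieszProduct n x) = 1 := by
  have h := rieszCoeff_zero n
  simp only [rieszCoeff, fourier_zero, one_mul] at h
  have h1 : ∫ x : UnitAddCircle, rieszProduct n x = 1 := by
    have h2 : ∫ x : UnitAddCircle, (rieszProduct n x : ℂ)
        = ((∫ x : UnitAddCircle, rieszProduct n x : ℝ) : ℂ) := integral_ofReal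
    rw [h2] at h
    exact_mod_cast h
  rw [← ofReal_integral_eq_lintegral_ofReal, h1, ENNReal.ofReal_one]
  · exact (continuous_rieszProduct n).integrable_of_hasCompactSupport
      (HasCompactSupport.of_compactSpace _)
  · exact Eventually.of_forall (rieszProduct_nonneg n)

/-- The absolutely continuous probability measure on the torus whose density with respect to
Lebesgue measure is the `n`-th partial Riesz product. -/
def rieszMeasure (n : ℕ) : ProbabilityMeasure UnitAddCircle :=
  ⟨(volume : Measure UnitAddCircle).withDensity fun x => ENNReal.ofReal (rieszProduct n x),
    ⟨by rw [withDensity_apply _ MeasurableSet.univ, Measure.restrict_univ,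
      lintegral_rieszProduct]⟩⟩

/-- The Thue--Morse measure `∏_{m ≥ 0} (1 - cos (2π 2^m x))` on the torus: the weak limit of the
probability measures `rieszMeasure n`. The limit exists, see `tendsto_rieszMeasure`. -/
def thueMorseTorus : ProbabilityMeasure UnitAddCircle :=
  @limUnder _ _ _ ⟨rieszMeasure 0⟩ atTop rieszMeasure

theorem integral_rieszMeasure (n : ℕ) (k : ℤ) :
    ∫ x, fourier k x ∂(rieszMeasure n : Measure UnitAddCircle) = rieszCoeff n k := by
  have : ((rieszMeasure n : ProbabilityMeasure UnitAddCircle) : Measure UnitAddCircle)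
    = (volume : Measure UnitAddCircle).withDensity
      fun x => ((Real.toNNReal (rieszProduct n x) : NNReal) : ℝ≥0∞) := rfl
  rw [this, integral_withDensity_eq_integral_smul
    (continuous_rieszProduct n).measurable.real_toNNReal]
  unfold rieszCoeff
  refine integral_congr_ae (Eventually.of_forall fun x => ?_)
  simp only [NNReal.smul_def, Real.coe_toNNReal _ (rieszProduct_nonneg n x), Complex.real_smul]
  ring

theorem tendsto_affine_recursion {a : ℕ → ℂ} (h : ∀ n, a (n + 1) = -(1 + a n) / 2) :
    Tendsto a atTop (𝓝 (-1 / 3)) := by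
  have h2 : ∀ n, a n = (-1 / 2) ^ n * (a 0 + 1 / 3) + (-1 / 3) := by
    intro n
    induction n with
    | zero => ring
    | succ n ih =>
      rw [h, ih]
      ring
  rw [show a = fun n => (-1 / 2) ^ n * (a 0 + 1 / 3) + (-1 / 3) from funext h2]
  have : Tendsto (fun n : ℕ => (-1 / 2 : ℂ) ^ n) atTop (𝓝 0) :=
    tendsto_pow_atTop_nhds_zero_of_norm_lt_one (by norm_num)
  simpa using (this.mul_const (a 0 + 1 / 3)).add_const (-1 / 3)

theorem exists_tendsto_rieszCoeff (N : ℕ) :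
    ∀ k : ℤ, k.natAbs = N → ∃ c, Tendsto (fun n => rieszCoeff n k) atTop (𝓝 c) := by
  induction N using Nat.strong_induction_on with
  | _ N ih =>
    intro k hk
    by_cases h0 : k = 0
    · subst h0
      exact ⟨1, by simp [rieszCoeff_zero]⟩
    by_cases h1 : k = 1
    · subst h1
      refine ⟨-1 / 3, tendsto_affine_recursion fun n => ?_⟩
      have := rieszCoeff_succ_odd n 0
      simp only [mul_zero, zero_add, rieszCoeff_zero] at this
      rw [this, add_comm]
    by_cases h2 : k = -1
    · subst h2
      refine ⟨-1 / 3, tendsto_affine_recursion fun n => ?_⟩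
      have := rieszCoeff_succ_odd n (-1)
      norm_num [rieszCoeff_zero] at this
      rw [this]
      ring
    obtain ⟨j, hj | hj⟩ := Int.even_or_odd' k
    · obtain ⟨c, hc⟩ := ih j.natAbs (by omega) j rfl
      refine ⟨c, (tendsto_add_atTop_iff_nat 1).mp ?_⟩
      simpa only [hj, rieszCoeff_succ_even] using hc
    · obtain ⟨c, hc⟩ := ih j.natAbs (by omega) j rfl
      obtain ⟨d, hd⟩ := ih (j + 1).natAbs (by omega) (j + 1) rfl
      refine ⟨-(d + c) / 2, (tendsto_add_atTop_iff_nat 1).mp ?_⟩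
      simpa only [hj, rieszCoeff_succ_odd] using (hd.add hc).neg.div_const 2

theorem exists_tendsto_rieszMeasure : ∃ ν, Tendsto rieszMeasure atTop (𝓝 ν) := by
  choose c hc using fun k : ℤ => exists_tendsto_rieszCoeff k.natAbs k rfl
  -- a cluster point has the limiting Fourier coefficients
  have hcl : ∀ ν : ProbabilityMeasure UnitAddCircle, MapClusterPt ν atTop rieszMeasure →
      ∀ k : ℤ, ∫ x, fourier k x ∂(ν : Measure UnitAddCircle) = c k := by
    intro ν hν k
    have hcont : Continuous fun ρ : ProbabilityMeasure UnitAddCircle =>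
        ∫ x, fourier k x ∂(ρ : Measure UnitAddCircle) := by
      have hre : Continuous fun ρ : ProbabilityMeasure UnitAddCircle =>
          ∫ x, (fourier k x).re ∂(ρ : Measure UnitAddCircle) :=
        ProbabilityMeasure.continuous_integral_boundedContinuousFunction
          (BoundedContinuousFunction.mkOfCompact
            ⟨fun x : UnitAddCircle => (fourier k x).re, by fun_prop⟩)
      have him : Continuous fun ρ : ProbabilityMeasure UnitAddCircle =>
          ∫ x, (fourier k x).im ∂(ρ : Measure UnitAddCircle) :=
        ProbabilityMeasure.continuous_integral_boundedContinuousFunction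
          (BoundedContinuousFunction.mkOfCompact
            ⟨fun x : UnitAddCircle => (fourier k x).im, by fun_prop⟩)
      have : (fun ρ : ProbabilityMeasure UnitAddCircle =>
          ∫ x, fourier k x ∂(ρ : Measure UnitAddCircle)) =
          fun ρ : ProbabilityMeasure UnitAddCircle =>
          ((∫ x, (fourier k x).re ∂(ρ : Measure UnitAddCircle) : ℝ) : ℂ)
            + ((∫ x, (fourier k x).im ∂(ρ : Measure UnitAddCircle) : ℝ) : ℂ) * Complex.I := by
        funext ρ
        have hi : Integrable (fun x => fourier k x) (ρ : Measure UnitAddCircle) :=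
          (fourier k).continuous.integrable_of_hasCompactSupport
            (HasCompactSupport.of_compactSpace _)
        exact (integral_re_add_im hi).symm
      rw [this]
      fun_prop
    have h1 : MapClusterPt (∫ x, fourier k x ∂(ν : Measure UnitAddCircle)) atTop
        (fun n => rieszCoeff n k) := by
      simpa only [Function.comp_def, integral_rieszMeasure] using
        hν.continuousAt_comp hcont.continuousAt
    have : Filter.NeBot (𝓝 (∫ x, fourier k x ∂(ν : Measure UnitAddCircle)) ⊓ 𝓝 (c k)) :=
      NeBot.mono h1 (inf_le_inf_left _ (hc k))
    exact eq_of_nhds_neBot this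
  have huniq : ∀ ν ν' : ProbabilityMeasure UnitAddCircle, MapClusterPt ν atTop rieszMeasure →
      MapClusterPt ν' atTop rieszMeasure → ν = ν' := by
    intro ν ν' h h'
    apply Subtype.ext
    let A : StarSubalgebra ℂ (BoundedContinuousFunction UnitAddCircle ℂ) :=
      (@fourierSubalgebra 1).comap
        (BoundedContinuousFunction.toContinuousMapStarₐ ℂ)
    have hf1 : IsFiniteMeasure (ν : Measure UnitAddCircle) := inferInstance
    have hf2 : IsFiniteMeasure (ν' : Measure UnitAddCircle) := inferInstance
    refine @ext_of_forall_mem_subalgebra_integral_eq_of_polish _ ℂ _ _ _ _ _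
      (ν : Measure UnitAddCircle) (ν' : Measure UnitAddCircle) hf1 hf2 A ?_ ?_
    · intro x y hxy
      obtain ⟨f, ⟨g, hg, rfl⟩, hne⟩ := fourierSubalgebra_separatesPoints (T := 1) hxy
      refine ⟨_, ⟨g, ⟨BoundedContinuousFunction.mkOfCompact g, ?_, ?_⟩, rfl⟩, hne⟩
      · exact hg
      · rfl
    · intro g hg
      have hg' : (g : C(UnitAddCircle, ℂ)) ∈ Submodule.span ℂ (Set.range (@fourier 1)) := by
        rw [← fourierSubalgebra_coe]
        exact hg
      have : ∀ f ∈ Submodule.span ℂ (Set.range (@fourier 1)),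
          ∫ x, f x ∂(ν : Measure UnitAddCircle) = ∫ x, f x ∂(ν' : Measure UnitAddCircle) := by
        intro f hf
        have hi : ∀ (ρ : ProbabilityMeasure UnitAddCircle) (f : C(UnitAddCircle, ℂ)),
            Integrable f (ρ : Measure UnitAddCircle) := fun ρ f =>
          f.continuous.integrable_of_hasCompactSupport (HasCompactSupport.of_compactSpace _)
        induction hf using Submodule.span_induction with
        | mem f hf =>
          obtain ⟨k, rfl⟩ := hf
          rw [hcl ν h k, hcl ν' h' k]
        | zero => simp
        | add f g _ _ h1 h2 =>
          simp only [ContinuousMap.add_apply]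
          rw [integral_add (hi _ _) (hi _ _), integral_add (hi _ _) (hi _ _), h1, h2]
        | smul a f _ h1 =>
          simp only [ContinuousMap.smul_apply]
          rw [integral_smul, integral_smul, h1]
      exact this _ hg'
  obtain ⟨ν, hν⟩ := exists_clusterPt_of_compactSpace (map rieszMeasure atTop)
  exact ⟨ν, le_nhds_of_unique_clusterPt fun ν' h' => huniq _ _ h' hν⟩

/-- The partial Riesz products do converge weakly to the Thue--Morse measure. -/
theorem tendsto_rieszMeasure : Tendsto rieszMeasure atTop (𝓝 thueMorseTorus) :=
  @tendsto_nhds_limUnder _ _ _ _ _ exists_tendsto_rieszMeasure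

/-- The space of one-sided binary sequences. The position `n ≥ 1` of a sequence corresponds to the
index `n - 1` here. -/
abbrev BinSeq : Type := ℕ → Fin 2

/-- The metric `d(x,y) = 2^{-j}`, where `j` is the smallest index (counted from `0`) with
`x j ≠ y j`. It induces the product topology. -/
instance BinSeq.metricSpace : MetricSpace BinSeq  := PiNat.metricSpace

/-- The left shift. -/
def shift (x : BinSeq) : BinSeq := fun n => x (n + 1)

/-- The binary expansion map `x ↦ ∑_{n ≥ 1} x_n 2^{-n}`, with values in the torus. -/
def binaryValue (x : BinSeq) : UnitAddCircle := (Real.ofDigits x : ℝ)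

/-- The binary digits of a point of the torus, represented in `[0,1)`, where dyadic rationals are
given the expansion that ends in zeros. -/
def binaryDigits (t : UnitAddCircle) : BinSeq := Real.digits (AddCircle.equivIco 1 0 t : ℝ) 2

theorem binaryValue_binaryDigits (t : UnitAddCircle) : binaryValue (binaryDigits t) = t := by
  have h : (AddCircle.equivIco 1 0 t : ℝ) ∈ Set.Ico (0 : ℝ) 1 := by
    simpa using (AddCircle.equivIco 1 0 t).2
  unfold binaryValue binaryDigits
  rw [Real.ofDigits_digits one_lt_two h]
  exact AddCircle.coe_equivIco

theorem measurable_binaryDigits : Measurable binaryDigits := by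
  have h : Measurable fun t : UnitAddCircle => (AddCircle.equivIco 1 0 t : ℝ) :=
    measurable_subtype_coe.comp (AddCircle.measurableEquivIco (1 : ℝ) 0).measurable
  refine measurable_pi_lambda _ fun n => ?_
  exact (measurable_from_top (f := fun k : ℕ => Fin.ofNat 2 k)).comp
    (Nat.measurable_floor.comp (h.mul_const _))

theorem measurable_binaryValue : Measurable binaryValue := by
  have h : Continuous binaryValue :=
    (AddCircle.continuous_mk' (1 : ℝ)).comp Real.continuous_ofDigits
  exact h.measurable

/-- The Thue--Morse measure on the space of binary sequences: the lift of the Thue--Morse measure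
on the torus along the binary expansion map. -/
def thueMorseMeasure : Measure BinSeq :=
  (thueMorseTorus : Measure UnitAddCircle).map binaryDigits

/-- The measure `thueMorseMeasure` is indeed a lift of the Thue--Morse measure on the torus. -/
theorem map_binaryValue_thueMorseMeasure :
    thueMorseMeasure.map binaryValue = (thueMorseTorus : Measure UnitAddCircle) := by
  unfold thueMorseMeasure
  rw [Measure.map_map measurable_binaryValue measurable_binaryDigits]
  have : binaryValue ∘ binaryDigits = id := funext binaryValue_binaryDigits
  rw [this, Measure.map_id]

/-- The potential `ψ(x) = log ((1 - cos (2π t)) / 2)`, with `t` the binary value of `x`. It takes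
values in `[-∞, 0]`, and the value `-∞` exactly where `t = 0`. -/
def psi (x : BinSeq) : EReal := ENNReal.log (ENNReal.ofReal (oneSubCos (binaryValue x) / 2))

/-- The Birkhoff sum `S_n ψ(x) = ∑_{m < n} ψ(σ^m x)`. -/
def birkhoffPsi (n : ℕ) (x : BinSeq) : EReal := ∑ m ∈ Finset.range n, psi (shift^[m] x)

end

noncomputable section

/-! The Thue–Morse measure is a `g`-measure for `g(t) = (1 - cos 2πt)/2 = sin² πt`. Hence
`μ(C_n(x))` is the `μ`-average over `y` of `∏_{m<n} g(σ^m(x_1⋯x_n y))` (`setLIntegral_cylinder`),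
while `exp (S_n ψ(x))` is the same product at `x` itself. Both limits therefore follow from the same
product estimates.

The size of `g` at a sequence is governed by its initial run of equal digits: a run of length `k`
gives `g ≤ π² 4^{-k}`, and a change of digit at index `k` gives `g ≥ 4^{-k}`
(`digitWeight_le_of_run`, `le_digitWeight_of_ne`). Reading through a full run of length `k` thus
costs `k(k+1) log 2` in `-log`, up to a bounded error per position. Since `γ > 1`, the total error
`O(n)` is negligible against `n^γ`.

Insert blocks of `k i` zeros at the sparse positions `p i = (i + i₀)^N`, with `∑_{j<i} k j (k j + 1)
∼ α (p i)^γ` (`exists_isBlockScheme`). Because `γ < 2`, such blocks have density zero once `N` is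
large. Outside the blocks, a 0 and a 1 prescribed in each period of length `q` keep runs bounded.
All sequences of this shape lie in both level sets (`IsBlockScheme.prod_bounds`,
`IsBlockScheme.measure_cylinder_bounds`, `IsBlockScheme.tendsto_neg_log`).

The prescribed positions have upper density at most `2/q`, so the set has dimension at least `1 -
2/q` (`le_dimH_of_forced_digits`). Letting `q` grow gives dimension at least 1, and 1 is the maximum
in this metric. -/

/-! ### Hausdorff dimension in the sequence space. -/

/-- The `2^n` cylinders of length `n` have diameter at most `2^{-n}`, so the 1-dimensional Hausdorff
measure is at most 1. -/
theorem dimH_binSeq_le_one (s : Set BinSeq) : dimH s ≤ 1 := by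
  have key : (μH[((1 : NNReal) : ℝ)] : Measure BinSeq) s ≤ 1 := by
    let t : ∀ n : ℕ, (Fin n → Fin 2) → Set BinSeq := fun n w => {x | ∀ i : Fin n, x i = w i}
    have hd : ∀ (n : ℕ) (w : Fin n → Fin 2), Metric.ediam (t n w) ≤ ENNReal.ofReal ((1 / 2) ^ n) := by
      intro n w
      refine Metric.ediam_le fun x hx y hy => ?_
      rw [edist_dist]
      refine ENNReal.ofReal_le_ofReal ?_
      refine PiNat.mem_cylinder_iff_dist_le.1 ?_
      intro i hi
      exact (hx ⟨i, hi⟩).trans (hy ⟨i, hi⟩).symm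
    have h0 : Tendsto (fun n : ℕ => ENNReal.ofReal ((1 / 2) ^ n)) atTop (𝓝 0) := by
      rw [← ENNReal.ofReal_zero]
      exact ENNReal.tendsto_ofReal (tendsto_pow_atTop_nhds_zero_of_lt_one (by norm_num) (by norm_num))
    refine (Measure.hausdorffMeasure_le_liminf_sum _ s _ h0 t
      (Eventually.of_forall fun n w => hd n w)
      (Eventually.of_forall fun n x _ => Set.mem_iUnion.2 ⟨fun i => x i, fun i => rfl⟩)).trans ?_
    refine liminf_le_of_le (by isBoundedDefault) fun b hb => ?_
    obtain ⟨n, hn⟩ := hb.exists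
    refine hn.trans ?_
    calc ∑ w, Metric.ediam (t n w) ^ ((1 : NNReal) : ℝ)
        ≤ ∑ _w : Fin n → Fin 2, ENNReal.ofReal ((1 / 2) ^ n) :=
          Finset.sum_le_sum fun w _ => by simpa using hd n w
      _ = 1 := by
        rw [Finset.sum_const, Finset.card_univ, Fintype.card_fun, Fintype.card_fin,
          Fintype.card_fin, nsmul_eq_mul, ← ENNReal.ofReal_natCast, ← ENNReal.ofReal_mul (by positivity)]
        push_cast
        rw [← mul_pow]
        norm_num
  exact_mod_cast dimH_le_of_hausdorffMeasure_ne_top (key.trans_lt ENNReal.one_lt_top).ne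

/-- Prescribing the digits on a set of positions of upper density at most `ε` leaves a set of
Hausdorff dimension at least `1 - ε`. -/
theorem le_dimH_of_forced_digits (F : ℕ → Prop) [DecidablePred F] (w : BinSeq) {ε : ℝ} {C : ℝ}
    (hε : ε < 1) (hF : ∀ n, (Nat.count F n : ℝ) ≤ ε * n + C) :
    ENNReal.ofReal (1 - ε) ≤ dimH {x : BinSeq | ∀ m, F m → x m = w m} := by
  set A : Set BinSeq := {x | ∀ m, F m → x m = w m} with hA
  have hcount : ∀ n, Nat.count F n + Nat.count (fun m => ¬ F m) n = n := by
    intro n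
    rw [Nat.count_eq_card_filter_range, Nat.count_eq_card_filter_range,
      Finset.card_filter_add_card_filter_not, Finset.card_range]
  have hinf : {m | ¬ F m}.Infinite := by
    intro hfin
    obtain ⟨n, hn⟩ := exists_nat_gt ((C + hfin.toFinset.card) / (1 - ε))
    rw [div_lt_iff₀ (by linarith)] at hn
    have h1 : Nat.count (fun m => ¬ F m) n ≤ hfin.toFinset.card := by
      rw [Nat.count_eq_card_filter_range]
      exact Finset.card_le_card fun m hm => by simpa using (Finset.mem_filter.1 hm).2
    have h2 : (Nat.count F n : ℝ) + Nat.count (fun m => ¬ F m) n = n := by exact_mod_cast hcount n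
    have h3 : (Nat.count (fun m => ¬ F m) n : ℝ) ≤ hfin.toFinset.card := by exact_mod_cast h1
    nlinarith [hF n]
  let e : ℕ → ℕ := Nat.nth fun m => ¬ F m
  -- `f` reads only the free digits, as a binary expansion. It maps `A` onto a set containing
  -- `[0,1)`.
  let f : BinSeq → ℝ := fun x => Real.ofDigits fun n => x (e n)
  have hsurj : Set.Ico (0 : ℝ) 1 ⊆ f '' A := by
    intro t ht
    refine ⟨fun m => if F m then w m else Real.digits t 2 (Nat.count (fun m => ¬ F m) m), ?_, ?_⟩
    · intro m hm
      simp [hm]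
    · have : (fun n => (fun m => if F m then w m else
          Real.digits t 2 (Nat.count (fun m => ¬ F m) m)) (e n)) = Real.digits t 2 := by
        funext n
        have h1 : ¬ F (e n) := Nat.nth_mem_of_infinite hinf n
        have h2 : Nat.count (fun m => ¬ F m) (e n) = n := Nat.count_nth_of_infinite hinf n
        simp only [h1, if_false, h2]
      simp only [f]
      rw [this, Real.ofDigits_digits one_lt_two ht]
  -- Sequences agreeing on their first `n` digits agree on at least `(1 - ε) n - C` free ones,
  -- whence exponent `1 - ε` and constant `2^C`.
  have hhol : HolderOnWith (Real.toNNReal (2 ^ C)) (Real.toNNReal (1 - ε)) f A := by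
    intro x hx y hy
    by_cases hxy : x = y
    · simp [hxy]
    set n := PiNat.firstDiff x y with hn
    have h1 : dist (f x) (f y) ≤ 2 ^ C * dist x y ^ (1 - ε) := by
      rw [PiNat.dist_eq_of_ne hxy, Real.dist_eq]
      have hle : |f x - f y| ≤ ((2 : ℕ) : ℝ)⁻¹ ^ Nat.count (fun m => ¬ F m) n := by
        have := Real.abs_ofDigits_sub_ofDigits_le (x := fun l => x (e l)) (y := fun l => y (e l))
          (n := Nat.count (fun m => ¬ F m) n) (fun l hl =>
            PiNat.apply_eq_of_lt_firstDiff (Nat.nth_lt_of_lt_count hl))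
        simpa using this
      refine hle.trans ?_
      have h2 : (Nat.count F n : ℝ) + Nat.count (fun m => ¬ F m) n = n := by exact_mod_cast hcount n
      have h3 : (((2 : ℕ) : ℝ)⁻¹) ^ Nat.count (fun m => ¬ F m) n
          = (2 : ℝ) ^ (-(Nat.count (fun m => ¬ F m) n : ℝ)) := by
        rw [Real.rpow_neg (by norm_num), Real.rpow_natCast, inv_pow]
        norm_num
      have h4 : ((1 / 2 : ℝ) ^ n) ^ (1 - ε) = 2 ^ (-(n : ℝ) * (1 - ε)) := by
        rw [Real.rpow_mul (by norm_num), Real.rpow_neg (by norm_num), Real.rpow_natCast, one_div,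
          inv_pow]
      rw [h3, h4, ← Real.rpow_add (by norm_num)]
      refine Real.rpow_le_rpow_of_exponent_le (by norm_num) ?_
      linarith [hF n]
    rw [edist_dist, edist_dist, Real.coe_toNNReal _ (by linarith),
      ENNReal.ofReal_rpow_of_nonneg dist_nonneg (by linarith)]
    change _ ≤ ENNReal.ofReal _ * _
    rw [← ENNReal.ofReal_mul (by positivity)]
    exact ENNReal.ofReal_le_ofReal h1
  have hpos : 0 < Real.toNNReal (1 - ε) := by simpa using hε
  have h1 := hhol.dimH_image_le hpos
  have h2 : (1 : ℝ≥0∞) ≤ dimH (f '' A) := by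
    refine le_trans ?_ (dimH_mono hsurj)
    rw [Real.dimH_of_nonempty_interior]
    · simp
    · simp
  have h3 := h2.trans h1
  rw [ENNReal.le_div_iff_mul_le (Or.inl (by simpa using hε)) (Or.inl (by simp)), one_mul] at h3
  exact h3

/-! ### Self-similarity of the Thue–Morse measure via Fourier coefficients. -/

theorem tendsto_integral_fourier {ν : ℕ → ProbabilityMeasure UnitAddCircle}
    {ρ : ProbabilityMeasure UnitAddCircle} (h : Tendsto ν atTop (𝓝 ρ)) (k : ℤ) :
    Tendsto (fun n => ∫ x, fourier k x ∂(ν n : Measure UnitAddCircle)) atTop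
      (𝓝 (∫ x, fourier k x ∂(ρ : Measure UnitAddCircle))) := by
  have hsplit : ∀ ρ : ProbabilityMeasure UnitAddCircle,
      ∫ x, fourier k x ∂(ρ : Measure UnitAddCircle) =
        ((∫ x, (fourier k x).re ∂(ρ : Measure UnitAddCircle) : ℝ) : ℂ)
          + ((∫ x, (fourier k x).im ∂(ρ : Measure UnitAddCircle) : ℝ) : ℂ) * Complex.I := fun ρ =>
    (integral_re_add_im ((fourier k).continuous.integrable_of_hasCompactSupport
      (HasCompactSupport.of_compactSpace _))).symm
  have hre : Continuous fun ρ : ProbabilityMeasure UnitAddCircle =>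
      ∫ x, (fourier k x).re ∂(ρ : Measure UnitAddCircle) :=
    ProbabilityMeasure.continuous_integral_boundedContinuousFunction
      (BoundedContinuousFunction.mkOfCompact
        ⟨fun x : UnitAddCircle => (fourier k x).re, by fun_prop⟩)
  have him : Continuous fun ρ : ProbabilityMeasure UnitAddCircle =>
      ∫ x, (fourier k x).im ∂(ρ : Measure UnitAddCircle) :=
    ProbabilityMeasure.continuous_integral_boundedContinuousFunction
      (BoundedContinuousFunction.mkOfCompact
        ⟨fun x : UnitAddCircle => (fourier k x).im, by fun_prop⟩)
  have hc : Continuous fun ρ : ProbabilityMeasure UnitAddCircle =>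
      ∫ x, fourier k x ∂(ρ : Measure UnitAddCircle) := by
    simp only [hsplit]
    fun_prop
  exact (hc.tendsto ρ).comp h

theorem measure_ext_of_integral_fourier {ν ν' : Measure UnitAddCircle} [IsFiniteMeasure ν]
    [IsFiniteMeasure ν'] (h : ∀ k : ℤ, ∫ x, fourier k x ∂ν = ∫ x, fourier k x ∂ν') : ν = ν' := by
  let A : StarSubalgebra ℂ (BoundedContinuousFunction UnitAddCircle ℂ) :=
    (@fourierSubalgebra 1).comap (BoundedContinuousFunction.toContinuousMapStarₐ ℂ)
  refine ext_of_forall_mem_subalgebra_integral_eq_of_polish (𝕜 := ℂ) (A := A) ?_ ?_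
  · intro x y hxy
    obtain ⟨f, ⟨g, hg, rfl⟩, hne⟩ := fourierSubalgebra_separatesPoints (T := 1) hxy
    exact ⟨_, ⟨g, ⟨BoundedContinuousFunction.mkOfCompact g, hg, rfl⟩, rfl⟩, hne⟩
  · intro g hg
    have hg' : (g : C(UnitAddCircle, ℂ)) ∈ Submodule.span ℂ (Set.range (@fourier 1)) := by
      rw [← fourierSubalgebra_coe]
      exact hg
    have hi : ∀ (ρ : Measure UnitAddCircle) [IsFiniteMeasure ρ] (f : C(UnitAddCircle, ℂ)),
        Integrable f ρ := fun ρ _ f =>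
      f.continuous.integrable_of_hasCompactSupport (HasCompactSupport.of_compactSpace _)
    have : ∀ f ∈ Submodule.span ℂ (Set.range (@fourier 1)), ∫ x, f x ∂ν = ∫ x, f x ∂ν' := by
      intro f hf
      induction hf using Submodule.span_induction with
      | mem f hf =>
        obtain ⟨k, rfl⟩ := hf
        exact h k
      | zero => simp
      | add f g _ _ h1 h2 =>
        simp only [ContinuousMap.add_apply]
        rw [integral_add (hi _ _) (hi _ _), integral_add (hi _ _) (hi _ _), h1, h2]
      | smul a f _ h1 =>
        simp only [ContinuousMap.smul_apply]
        rw [integral_smul, integral_smul, h1]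
    exact this _ hg'

/-- Fourier coefficients of the Thue--Morse measure. -/
def thueMorseCoeff (k : ℤ) : ℂ := ∫ x, fourier k x ∂(thueMorseTorus : Measure UnitAddCircle)

theorem tendsto_rieszCoeff (k : ℤ) :
    Tendsto (fun n => rieszCoeff n k) atTop (𝓝 (thueMorseCoeff k)) := by
  simpa only [integral_rieszMeasure, thueMorseCoeff] using
    tendsto_integral_fourier tendsto_rieszMeasure k

theorem thueMorseCoeff_even (j : ℤ) : thueMorseCoeff (2 * j) = thueMorseCoeff j :=
  tendsto_nhds_unique ((tendsto_add_atTop_iff_nat 1).mpr (tendsto_rieszCoeff (2 * j)))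
    (by simpa only [rieszCoeff_succ_even] using tendsto_rieszCoeff j)

theorem thueMorseCoeff_odd (j : ℤ) :
    thueMorseCoeff (2 * j + 1) = -(thueMorseCoeff (j + 1) + thueMorseCoeff j) / 2 :=
  tendsto_nhds_unique ((tendsto_add_atTop_iff_nat 1).mpr (tendsto_rieszCoeff (2 * j + 1)))
    (by simpa only [rieszCoeff_succ_odd] using
      ((tendsto_rieszCoeff (j + 1)).add (tendsto_rieszCoeff j)).neg.div_const 2)

/-- The two inverse branches of the doubling map. -/
def halfBranch (j : Fin 2) (t : UnitAddCircle) : UnitAddCircle :=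
  ((((AddCircle.equivIco 1 0 t : ℝ) + (j : ℕ)) / 2 : ℝ) : UnitAddCircle)

theorem measurable_halfBranch (j : Fin 2) : Measurable (halfBranch j) := by
  have h : Measurable fun t : UnitAddCircle => (AddCircle.equivIco 1 0 t : ℝ) :=
    measurable_subtype_coe.comp (AddCircle.measurableEquivIco (1 : ℝ) 0).measurable
  exact (AddCircle.continuous_mk' (1 : ℝ)).measurable.comp ((h.add_const _).div_const _)

theorem two_nsmul_halfBranch (j : Fin 2) (t : UnitAddCircle) : 2 • halfBranch j t = t := by
  have h : (((AddCircle.equivIco 1 0 t : ℝ)) : UnitAddCircle) = t := AddCircle.coe_equivIco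
  unfold halfBranch
  rw [← AddCircle.coe_nsmul, nsmul_eq_mul]
  push_cast
  rw [mul_div_cancel₀ _ (two_ne_zero), AddCircle.coe_add, h]
  have : (((j : ℕ) : ℝ) : UnitAddCircle) = 0 := by
    have := AddCircle.coe_period (1 : ℝ)
    rw [← nsmul_one (j : ℕ), AddCircle.coe_nsmul, this, smul_zero]
  rw [this, add_zero]

theorem halfBranch_one (t : UnitAddCircle) :
    halfBranch 1 t = halfBranch 0 t + ((1 / 2 : ℝ) : UnitAddCircle) := by
  unfold halfBranch
  rw [← AddCircle.coe_add]
  congr 1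
  simp
  ring

theorem fourier_halfBranch_even (i : Fin 2) (j : ℤ) (t : UnitAddCircle) :
    fourier (2 * j) (halfBranch i t) = fourier j t := by
  conv_rhs => rw [← two_nsmul_halfBranch i t]
  simp only [fourier_apply]
  congr 2
  rw [mul_comm, mul_smul]
  rfl

/-- The two preimages under doubling differ by `1/2`, where odd characters take the value `-1`. -/
theorem fourier_halfBranch_odd (j : ℤ) (t : UnitAddCircle) :
    fourier (2 * j + 1) (halfBranch 1 t) = -fourier (2 * j + 1) (halfBranch 0 t) := by
  have hf : fourier (2 * j + 1) ((1 / 2 : ℝ) : UnitAddCircle) = (-1 : ℂ) := by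
    rw [fourier_coe_apply]
    have : 2 * (Real.pi : ℂ) * Complex.I * ((2 * j + 1 : ℤ) : ℂ) * ((1 / 2 : ℝ) : ℂ) / ((1 : ℝ) : ℂ)
        = (Real.pi : ℂ) * Complex.I + j * (2 * Real.pi * Complex.I) := by
      push_cast
      ring
    rw [this, Complex.exp_add, Complex.exp_int_mul_two_pi_mul_I, Complex.exp_pi_mul_I, mul_one]
  have : (fourier (2 * j + 1) (halfBranch 1 t) : ℂ)
      = fourier (2 * j + 1) (halfBranch 0 t) * fourier (2 * j + 1) ((1 / 2 : ℝ) : UnitAddCircle) := by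
    rw [halfBranch_one]
    simp [fourier_apply, smul_add, AddCircle.toCircle_add]
  rw [this, hf]
  ring

/-- With `transfer_fourier_odd`, this computes the transfer operator of `g` on characters. It
reproduces exactly the recursions `thueMorseCoeff_even` and `thueMorseCoeff_odd`. -/
theorem transfer_fourier_even (j : ℤ) (t : UnitAddCircle) :
    (oneSubCos (halfBranch 0 t) / 2 : ℂ) * fourier (2 * j) (halfBranch 0 t)
      + (oneSubCos (halfBranch 1 t) / 2 : ℂ) * fourier (2 * j) (halfBranch 1 t) = fourier j t := by
  have h1 := fourier_halfBranch_odd 0 t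
  have h2 := fourier_halfBranch_odd (-1) t
  norm_num at h1 h2
  rw [oneSubCos_eq_fourier, oneSubCos_eq_fourier, fourier_halfBranch_even, fourier_halfBranch_even]
  norm_num [h1, h2]
  ring

theorem transfer_fourier_odd (j : ℤ) (t : UnitAddCircle) :
    (oneSubCos (halfBranch 0 t) / 2 : ℂ) * fourier (2 * j + 1) (halfBranch 0 t)
      + (oneSubCos (halfBranch 1 t) / 2 : ℂ) * fourier (2 * j + 1) (halfBranch 1 t)
      = -(fourier (j + 1) t + fourier j t) / 2 := by
  have e1 : ∀ i, (fourier 1 (halfBranch i t) : ℂ) * fourier (2 * j + 1) (halfBranch i t)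
      = fourier (j + 1) t := fun i => by
    rw [← fourier_add, show 1 + (2 * j + 1) = 2 * (j + 1) by ring, fourier_halfBranch_even]
  have e2 : ∀ i, (fourier (-1) (halfBranch i t) : ℂ) * fourier (2 * j + 1) (halfBranch i t)
      = fourier j t := fun i => by
    rw [← fourier_add, show -1 + (2 * j + 1) = 2 * j by ring, fourier_halfBranch_even]
  rw [oneSubCos_eq_fourier, oneSubCos_eq_fourier]
  linear_combination fourier_halfBranch_odd j t / 2 - (e1 0 + e2 0 + e1 1 + e2 1) / 4

/-- The weight `g = (1 - cos (2π x)) / 2`, as an extended nonnegative real. -/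
def tmWeight (t : UnitAddCircle) : ℝ≥0∞ := ENNReal.ofReal (oneSubCos t / 2)

theorem measurable_tmWeight : Measurable tmWeight :=
  (continuous_oneSubCos.measurable.div_const _).ennreal_ofReal

theorem oneSubCos_le_two (t : UnitAddCircle) : oneSubCos t ≤ 2 := by
  induction t using QuotientAddGroup.induction_on with
  | H x =>
    rw [oneSubCos_coe]
    linarith [Real.neg_one_le_cos (2 * Real.pi * x)]

theorem tmWeight_le_one (t : UnitAddCircle) : tmWeight t ≤ 1 := by
  unfold tmWeight
  rw [← ENNReal.ofReal_one]
  exact ENNReal.ofReal_le_ofReal (by linarith [oneSubCos_le_two t])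

/-- The image of the weighted measure `g ∘ b · μ` under an inverse branch `b`. -/
def branchMeasure (j : Fin 2) : Measure UnitAddCircle :=
  ((thueMorseTorus : Measure UnitAddCircle).withDensity
    fun t => tmWeight (halfBranch j t)).map (halfBranch j)

instance isFiniteMeasure_branchMeasure (j : Fin 2) : IsFiniteMeasure (branchMeasure j) := by
  have : IsFiniteMeasure ((thueMorseTorus : Measure UnitAddCircle).withDensity
      fun t => tmWeight (halfBranch j t)) := by
    refine isFiniteMeasure_withDensity (ne_of_lt ?_)
    refine (lintegral_mono fun t => tmWeight_le_one _).trans_lt ?_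
    simp
  unfold branchMeasure
  infer_instance

theorem integral_fourier_branchMeasure (j : Fin 2) (k : ℤ) :
    ∫ x, fourier k x ∂(branchMeasure j) = ∫ t, (oneSubCos (halfBranch j t) / 2 : ℂ)
      * fourier k (halfBranch j t) ∂(thueMorseTorus : Measure UnitAddCircle) := by
  unfold branchMeasure
  rw [integral_map (measurable_halfBranch j).aemeasurable
    (fourier k).continuous.aestronglyMeasurable]
  have h : Measurable fun t => Real.toNNReal (oneSubCos (halfBranch j t) / 2) :=
    ((continuous_oneSubCos.measurable.comp (measurable_halfBranch j)).div_const _).real_toNNReal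
  refine (integral_withDensity_eq_integral_smul h _).trans ?_
  refine integral_congr_ae (Eventually.of_forall fun x => ?_)
  have h0 : 0 ≤ oneSubCos (halfBranch j x) / 2 := by linarith [oneSubCos_nonneg (halfBranch j x)]
  simp only [NNReal.smul_def, Real.coe_toNNReal _ h0, Complex.real_smul]
  push_cast
  rfl

/-- The measure is fixed by the dual of the transfer operator: integrating a character against the
right side integrates its transfer, so the coefficients agree by the recursion, and Fourier
coefficients determine a finite measure. -/
theorem thueMorseTorus_eq_branchMeasure_add :
    (thueMorseTorus : Measure UnitAddCircle) = branchMeasure 0 + branchMeasure 1 := by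
  refine measure_ext_of_integral_fourier fun k => ?_
  have hi : ∀ (i : Fin 2) (k : ℤ), Integrable (fun t => (oneSubCos (halfBranch i t) / 2 : ℂ)
      * fourier k (halfBranch i t)) (thueMorseTorus : Measure UnitAddCircle) := by
    intro i k
    have hc : Continuous fun t : UnitAddCircle => (oneSubCos t / 2 : ℂ) * fourier k t :=
      ((Complex.continuous_ofReal.comp continuous_oneSubCos).div_const _).mul (fourier k).continuous
    refine Integrable.of_bound (C := 1)
      (hc.measurable.comp (measurable_halfBranch i)).aestronglyMeasurable
      (Eventually.of_forall fun t => ?_)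
    rw [norm_mul]
    have : ‖(oneSubCos (halfBranch i t) / 2 : ℂ)‖ ≤ 1 := by
      rw [← Complex.ofReal_ofNat, ← Complex.ofReal_div, Complex.norm_real, Real.norm_of_nonneg]
      · linarith [oneSubCos_le_two (halfBranch i t)]
      · linarith [oneSubCos_nonneg (halfBranch i t)]
    rw [fourier_apply, Circle.norm_coe, mul_one]
    exact this
  have hf : ∀ (ρ : Measure UnitAddCircle) [IsFiniteMeasure ρ] (k : ℤ),
      Integrable (fun x => (fourier k x : ℂ)) ρ := fun ρ _ k =>
    (fourier k).continuous.integrable_of_hasCompactSupport (HasCompactSupport.of_compactSpace _)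
  rw [integral_add_measure (hf _ k) (hf _ k), integral_fourier_branchMeasure,
    integral_fourier_branchMeasure, ← integral_add (hi 0 k) (hi 1 k)]
  change thueMorseCoeff k = _
  obtain ⟨j, rfl | rfl⟩ := Int.even_or_odd' k
  · simp only [transfer_fourier_even]
    exact thueMorseCoeff_even j
  · simp only [transfer_fourier_odd]
    rw [integral_div, integral_neg, integral_add (hf _ _) (hf _ _)]
    exact thueMorseCoeff_odd j

/-- Prepend a digit. -/
def consDigit (j : Fin 2) (y : BinSeq) : BinSeq
  | 0 => j
  | n + 1 => y n

theorem measurable_consDigit (j : Fin 2) : Measurable (consDigit j) := by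
  refine measurable_pi_lambda _ fun n => ?_
  cases n with
  | zero => exact measurable_const
  | succ n => exact measurable_pi_apply n

/-- This conjugates the inverse branches to prepending a digit. It holds at every point, dyadic ones
included, because `(r + j) / 2` stays in `[0,1)` and digits are defined by floors. -/
theorem binaryDigits_halfBranch (j : Fin 2) (t : UnitAddCircle) :
    binaryDigits (halfBranch j t) = consDigit j (binaryDigits t) := by
  have ht : (AddCircle.equivIco 1 0 t : ℝ) ∈ Set.Ico (0 : ℝ) 1 := by
    simpa using (AddCircle.equivIco 1 0 t).2
  set r : ℝ := (AddCircle.equivIco 1 0 t : ℝ) with hr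
  have hj : ((j : ℕ) : ℝ) ≤ 1 := by exact_mod_cast Nat.le_of_lt_succ j.2
  have hmem : (r + (j : ℕ)) / 2 ∈ Set.Ico (0 : ℝ) (0 + 1) := by
    constructor
    · have := ht.1
      positivity
    · linarith [ht.2]
  have h1 : (AddCircle.equivIco 1 0 (halfBranch j t) : ℝ) = (r + (j : ℕ)) / 2 := by
    unfold halfBranch
    rw [AddCircle.equivIco_coe_eq hmem]
  unfold binaryDigits
  rw [h1, ← hr]
  funext n
  cases n with
  | zero =>
    have : ⌊r + ((j : ℕ) : ℝ)⌋₊ = (j : ℕ) := by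
      rw [Nat.floor_add_natCast ht.1, Nat.floor_eq_zero.2 ht.2, zero_add]
    simp [Real.digits, consDigit, this]
  | succ n =>
    -- The added integer `j * 2 ^ (n + 1)` is even, so it does not change the digit.
    have h2 : (r + ((j : ℕ) : ℝ)) / 2 * (2 : ℕ) ^ (n + 1 + 1)
        = r * (2 : ℕ) ^ (n + 1) + ((j : ℕ) * 2 ^ (n + 1) : ℕ) := by
      push_cast
      ring
    have h3 : 0 ≤ r * ((2 : ℕ) : ℝ) ^ (n + 1) := mul_nonneg ht.1 (by positivity)
    simp only [Real.digits, consDigit]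
    rw [h2, Nat.floor_add_natCast h3]
    ext
    simp only [Fin.ofNat, pow_succ, ← mul_assoc, Nat.add_mul_mod_self_right]

/-- The Thue--Morse measure is the `g`-measure for `tmWeight ∘ binaryValue`. -/
theorem lintegral_thueMorseMeasure {F : BinSeq → ℝ≥0∞} (hF : Measurable F) :
    ∫⁻ z, F z ∂thueMorseMeasure = ∑ j : Fin 2,
      ∫⁻ y, tmWeight (binaryValue (consDigit j y)) * F (consDigit j y) ∂thueMorseMeasure := by
  have hT : ∀ H : UnitAddCircle → ℝ≥0∞, Measurable H →
      ∫⁻ t, H t ∂(thueMorseTorus : Measure UnitAddCircle) = ∑ j : Fin 2,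
        ∫⁻ t, tmWeight (halfBranch j t) * H (halfBranch j t)
          ∂(thueMorseTorus : Measure UnitAddCircle) := by
    intro H hH
    have hb : ∀ j, ∫⁻ t, H t ∂(branchMeasure j) = ∫⁻ t, tmWeight (halfBranch j t)
        * H (halfBranch j t) ∂(thueMorseTorus : Measure UnitAddCircle) := fun j => by
      unfold branchMeasure
      rw [lintegral_map hH (measurable_halfBranch j)]
      exact lintegral_withDensity_eq_lintegral_mul _
        (measurable_tmWeight.comp (measurable_halfBranch j)) (hH.comp (measurable_halfBranch j))
    rw [Fin.sum_univ_two, ← hb, ← hb, ← lintegral_add_measure,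
      ← thueMorseTorus_eq_branchMeasure_add]
  unfold thueMorseMeasure
  rw [lintegral_map hF measurable_binaryDigits]
  refine (hT _ (hF.comp measurable_binaryDigits)).trans ?_
  refine Finset.sum_congr rfl fun j _ => ?_
  rw [lintegral_map _ measurable_binaryDigits]
  · simp only [← binaryDigits_halfBranch, binaryValue_binaryDigits, Function.comp_apply]
  · exact (measurable_tmWeight.comp (measurable_binaryValue.comp (measurable_consDigit j))).mul
      (hF.comp (measurable_consDigit j))

/-! ### The weight in terms of runs of digits. -/

/-- The weight `(1 - cos (2π t)) / 2` with `t` the binary value of a sequence. -/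
def digitWeight (x : BinSeq) : ℝ := oneSubCos (binaryValue x) / 2

theorem tmWeight_binaryValue (x : BinSeq) :
    tmWeight (binaryValue x) = ENNReal.ofReal (digitWeight x) := rfl

theorem psi_eq_log (x : BinSeq) : psi x = ENNReal.log (ENNReal.ofReal (digitWeight x)) := rfl

theorem digitWeight_eq_sin_sq (x : BinSeq) :
    digitWeight x = Real.sin (Real.pi * Real.ofDigits x) ^ 2 := by
  unfold digitWeight binaryValue
  rw [oneSubCos_coe, mul_assoc, Real.cos_two_mul, Real.sin_sq]
  ring

theorem digitWeight_nonneg (x : BinSeq) : 0 ≤ digitWeight x := by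
  rw [digitWeight_eq_sin_sq]
  positivity

theorem ofDigits_add_ofDigits_rev (x : BinSeq) :
    Real.ofDigits x + Real.ofDigits (fun n => Fin.rev (x n)) = 1 := by
  have h := Real.ofDigits_const_last_eq_one' one_lt_two
  rw [← h]
  unfold Real.ofDigits
  rw [← Summable.tsum_add Real.summable_ofDigitsTerm Real.summable_ofDigitsTerm]
  refine tsum_congr fun n => ?_
  simp only [Real.ofDigitsTerm]
  rw [← add_mul]
  congr 1
  generalize x n = a
  fin_cases a <;> simp

/-- Flipping all digits reflects `t` to `1 - t`, which preserves `sin² πt`. The run estimates may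
thus assume that the first digit is 0. -/
theorem digitWeight_rev (x : BinSeq) : digitWeight (fun n => Fin.rev (x n)) = digitWeight x := by
  rw [digitWeight_eq_sin_sq, digitWeight_eq_sin_sq,
    show Real.ofDigits (fun n => Fin.rev (x n)) = 1 - Real.ofDigits x by
      linarith [ofDigits_add_ofDigits_rev x], mul_sub, mul_one, Real.sin_pi_sub]

/-- A run of `k` zeros forces `t ≤ 2^{-k}`; then `|sin πt| ≤ πt`. -/
theorem digitWeight_le_of_run {x : BinSeq} {k : ℕ} (h : ∀ j < k, x j = x 0) :
    digitWeight x ≤ Real.pi ^ 2 * (1 / 4) ^ k := by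
  wlog h0 : x 0 = 0 generalizing x
  · rw [← digitWeight_rev]
    refine this (fun j hj => by rw [h j hj]) ?_
    generalize x 0 = a at h0
    fin_cases a <;> simp at h0 ⊢
  have hle : Real.ofDigits x ≤ (1 / 2) ^ k := by
    have h1 := Real.abs_ofDigits_sub_ofDigits_le (x := x) (y := fun _ => 0) (n := k)
      (fun i hi => (h i hi).trans h0)
    have h2 : Real.ofDigits (fun _ : ℕ => (0 : Fin 2)) = 0 := by
      simp [Real.ofDigits, Real.ofDigitsTerm]
    rw [h2, sub_zero] at h1
    simpa using (le_abs_self _).trans h1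
  rw [digitWeight_eq_sin_sq, ← sq_abs]
  have h3 : |Real.sin (Real.pi * Real.ofDigits x)| ≤ Real.pi * (1 / 2) ^ k := by
    refine Real.abs_sin_le_abs.trans ?_
    rw [abs_of_nonneg (mul_nonneg Real.pi_pos.le (Real.ofDigits_nonneg _))]
    exact mul_le_mul_of_nonneg_left hle Real.pi_pos.le
  calc _ ≤ (Real.pi * (1 / 2) ^ k) ^ 2 := pow_le_pow_left₀ (abs_nonneg _) h3 2
    _ = Real.pi ^ 2 * (1 / 4) ^ k := by
      rw [mul_pow, ← pow_mul, mul_comm k, pow_mul]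
      norm_num

/-- With first digit 0, a digit 1 at index `k` gives `2^{-(k+1)} ≤ t ≤ 1/2`. On this range Jordan's
inequality gives `sin πt ≥ 2t`. -/
theorem le_digitWeight_of_ne {x : BinSeq} {k : ℕ} (h : x k ≠ x 0) :
    (1 / 4) ^ k ≤ digitWeight x := by
  wlog h0 : x 0 = 0 generalizing x
  · rw [← digitWeight_rev]
    refine this (fun he => h (Fin.rev_injective he)) ?_
    generalize x 0 = a at h0
    fin_cases a <;> simp at h0 ⊢
  have hk : x k = 1 := by
    rw [h0] at h
    generalize x k = a at h
    fin_cases a <;> simp at h ⊢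
  have hlow : (1 / 2) ^ (k + 1) ≤ Real.ofDigits x := by
    have h1 := Real.summable_ofDigitsTerm.le_tsum (f := Real.ofDigitsTerm x) k
      (fun i _ => Real.ofDigitsTerm_nonneg)
    rw [show Real.ofDigitsTerm x k = (1 / 2) ^ (k + 1) by simp [Real.ofDigitsTerm, hk]] at h1
    exact h1
  have hup : Real.ofDigits x ≤ 1 / 2 := by
    rw [Real.ofDigits_eq_sum_add_ofDigits x 1]
    have := Real.ofDigits_le_one fun i => x (i + 1)
    simp [Real.ofDigitsTerm, h0]
    linarith
  have hs : (1 / 2) ^ k ≤ Real.sin (Real.pi * Real.ofDigits x) := by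
    have h1 := Real.mul_le_sin (x := Real.pi * Real.ofDigits x)
      (mul_nonneg Real.pi_pos.le (Real.ofDigits_nonneg _)) (by nlinarith [Real.pi_pos])
    have h2 : 2 / Real.pi * (Real.pi * Real.ofDigits x) = 2 * Real.ofDigits x := by
      field_simp
    rw [h2] at h1
    rw [pow_succ] at hlow
    linarith
  rw [digitWeight_eq_sin_sq]
  calc (1 / 4 : ℝ) ^ k = ((1 / 2) ^ k) ^ 2 := by
        rw [← pow_mul, mul_comm k, pow_mul]
        norm_num
    _ ≤ _ := pow_le_pow_left₀ (by positivity) hs 2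

theorem shift_iterate_apply (m n : ℕ) (x : BinSeq) : (shift^[m] x) n = x (m + n) := by
  induction m generalizing x with
  | zero => simp
  | succ m ih =>
    rw [Function.iterate_succ_apply, ih, shift]
    congr 1
    omega

theorem digitWeight_shift_le_of_run {x : BinSeq} {m k : ℕ} (h : ∀ j < k, x (m + j) = x m) :
    digitWeight (shift^[m] x) ≤ Real.pi ^ 2 * (1 / 4) ^ k :=
  digitWeight_le_of_run fun j hj => by simpa [shift_iterate_apply] using h j hj

theorem le_digitWeight_shift_of_ne {x : BinSeq} {m k : ℕ} (h : x (m + k) ≠ x m) :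
    (1 / 4) ^ k ≤ digitWeight (shift^[m] x) :=
  le_digitWeight_of_ne (by simpa [shift_iterate_apply] using h)

/-! ### The measure of cylinders. -/

theorem measurable_digitWeight : Measurable digitWeight :=
  (continuous_oneSubCos.measurable.comp measurable_binaryValue).div_const _

instance isProbabilityMeasure_thueMorseMeasure : IsProbabilityMeasure thueMorseMeasure :=
  Measure.isProbabilityMeasure_map measurable_binaryDigits.aemeasurable

/-- `concatDigits x n y` consists of the first `n` digits of `x`, followed by `y`. -/
def concatDigits (x : BinSeq) : ℕ → BinSeq → BinSeq
  | 0, y => y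
  | n + 1, y => consDigit (x 0) (concatDigits (shift x) n y)

theorem concatDigits_apply_of_lt (x : BinSeq) {n m : ℕ} (h : m < n) (y : BinSeq) :
    concatDigits x n y m = x m := by
  induction n generalizing x m with
  | zero => omega
  | succ n ih =>
    cases m with
    | zero => rfl
    | succ m => exact ih (shift x) (by omega)

theorem concatDigits_apply_add (x : BinSeq) (n m : ℕ) (y : BinSeq) :
    concatDigits x n y (n + m) = y m := by
  induction n generalizing x with
  | zero => simp [concatDigits]
  | succ n ih =>
    rw [show n + 1 + m = n + m + 1 by omega]
    exact ih (shift x)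

theorem concatDigits_mem_cylinder (x : BinSeq) (n : ℕ) (y : BinSeq) :
    concatDigits x n y ∈ PiNat.cylinder x n := fun _ hi => concatDigits_apply_of_lt x hi y

theorem consDigit_mem_cylinder_succ {x y : BinSeq} {n : ℕ} {j : Fin 2} :
    consDigit j y ∈ PiNat.cylinder x (n + 1) ↔ j = x 0 ∧ y ∈ PiNat.cylinder (shift x) n := by
  constructor
  · exact fun h => ⟨h 0 (by omega), fun i hi => h (i + 1) (by omega)⟩
  · rintro ⟨h1, h2⟩ i hi
    cases i with
    | zero => exact h1
    | succ i => exact h2 i (by omega)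

theorem measurableSet_cylinder (x : BinSeq) (n : ℕ) : MeasurableSet (PiNat.cylinder x n) := by
  rw [PiNat.cylinder_eq_pi]
  exact MeasurableSet.pi (Finset.countable_toSet _) fun i _ => measurableSet_singleton _

/-- Iterates the `g`-measure identity; at each step only the branch `j = x 0` meets the cylinder. A
general `F` is needed in the induction, since it absorbs the weight of the digit peeled off. -/
theorem setLIntegral_cylinder (x : BinSeq) (n : ℕ) {F : BinSeq → ℝ≥0∞} (hF : Measurable F) :
    ∫⁻ z, (PiNat.cylinder x n).indicator F z ∂thueMorseMeasure
      = ∫⁻ y, (∏ m ∈ Finset.range n,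
          ENNReal.ofReal (digitWeight (shift^[m] (concatDigits x n y))))
          * F (concatDigits x n y) ∂thueMorseMeasure := by
  induction n generalizing x F with
  | zero => simp [concatDigits]
  | succ n ih =>
    rw [lintegral_thueMorseMeasure (hF.indicator (measurableSet_cylinder _ _)),
      Finset.sum_eq_single (x 0)]
    · have h1 : ∀ y, tmWeight (binaryValue (consDigit (x 0) y))
          * (PiNat.cylinder x (n + 1)).indicator F (consDigit (x 0) y)
          = (PiNat.cylinder (shift x) n).indicator (fun y =>
            ENNReal.ofReal (digitWeight (consDigit (x 0) y)) * F (consDigit (x 0) y)) y := by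
        intro y
        by_cases hy : y ∈ PiNat.cylinder (shift x) n
        · rw [Set.indicator_of_mem hy,
            Set.indicator_of_mem (consDigit_mem_cylinder_succ.2 ⟨rfl, hy⟩), tmWeight_binaryValue]
        · rw [Set.indicator_of_notMem hy, Set.indicator_of_notMem
            fun h => hy (consDigit_mem_cylinder_succ.1 h).2, mul_zero]
      simp only [h1]
      refine (ih (shift x) ((measurable_digitWeight.comp
        (measurable_consDigit _)).ennreal_ofReal.mul (hF.comp (measurable_consDigit _)))).trans ?_
      refine lintegral_congr fun y => ?_
      rw [Finset.prod_range_succ', mul_assoc]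
      rfl
    · intro j _ hj
      have h1 : ∀ y, (PiNat.cylinder x (n + 1)).indicator F (consDigit j y) = 0 := fun y =>
        Set.indicator_of_notMem (fun h => hj (consDigit_mem_cylinder_succ.1 h).1) _
      simp [h1]
    · simp

theorem thueMorseMeasure_cylinder_le {x : BinSeq} {n : ℕ} {U : ℝ≥0∞}
    (h : ∀ y ∈ PiNat.cylinder x n,
      ∏ m ∈ Finset.range n, ENNReal.ofReal (digitWeight (shift^[m] y)) ≤ U) :
    thueMorseMeasure (PiNat.cylinder x n) ≤ U := by
  have h1 := setLIntegral_cylinder x n (F := fun _ => 1) measurable_const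
  rw [lintegral_indicator (measurableSet_cylinder _ _), setLIntegral_one] at h1
  rw [h1]
  calc _ ≤ ∫⁻ _y, U ∂thueMorseMeasure :=
        lintegral_mono fun y => by simpa using h _ (concatDigits_mem_cylinder x n y)
    _ = U := by simp

theorem measurableSet_head (i : Fin 2) : MeasurableSet {y : BinSeq | y 0 = i} :=
  (measurable_pi_apply (X := fun _ : ℕ => Fin 2) 0) (measurableSet_singleton i)

/-- If `y` does not start with `i`, then `i y` changes digit at index 1 and has weight at least
`1/4`. Hence `μ(S) ≥ (1 - μ(S)) / 4`, that is `μ(S) ≥ 1/5`. -/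
theorem le_thueMorseMeasure_head (i : Fin 2) :
    ENNReal.ofReal (1 / 5) ≤ thueMorseMeasure {y : BinSeq | y 0 = i} := by
  set S : Set BinSeq := {y | y 0 = i} with hS
  have hm : MeasurableSet S := measurableSet_head i
  have h1 : ENNReal.ofReal (1 / 4) * thueMorseMeasure Sᶜ ≤ thueMorseMeasure S := by
    have h2 := lintegral_thueMorseMeasure (F := S.indicator 1) (measurable_one.indicator hm)
    rw [lintegral_indicator_one hm] at h2
    rw [h2]
    refine le_trans ?_ (Finset.single_le_sum (f := fun j => ∫⁻ y,
      tmWeight (binaryValue (consDigit j y)) * S.indicator 1 (consDigit j y) ∂thueMorseMeasure)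
      (fun _ _ => zero_le) (Finset.mem_univ i))
    rw [← lintegral_indicator_const hm.compl]
    refine lintegral_mono fun y => ?_
    have h3 : consDigit i y ∈ S := rfl
    by_cases hy : y ∈ Sᶜ
    · have h4 : (1 / 4 : ℝ) ^ 1 ≤ digitWeight (consDigit i y) := le_digitWeight_of_ne (k := 1) hy
      simp only [Set.indicator_of_mem hy, Set.indicator_of_mem h3, Pi.one_apply, mul_one]
      exact ENNReal.ofReal_le_ofReal (by rw [pow_one] at h4; exact h4)
    · simp [Set.indicator_of_notMem hy]
  have h5 : (thueMorseMeasure S).toReal + (thueMorseMeasure Sᶜ).toReal = 1 := by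
    rw [← ENNReal.toReal_add (measure_ne_top _ _) (measure_ne_top _ _), measure_add_measure_compl hm]
    simp
  have h6 := ENNReal.toReal_mono (measure_ne_top _ _) h1
  rw [ENNReal.toReal_mul, ENNReal.toReal_ofReal (by norm_num)] at h6
  rw [ENNReal.ofReal_le_iff_le_toReal (measure_ne_top _ _)]
  linarith

/-- On the whole cylinder the product has no useful lower bound, since the last run of the prefix
may continue far into `y`. Fixing the next digit stops that run at the cost of a factor `1/5`. -/
theorem le_thueMorseMeasure_cylinder {x : BinSeq} {n : ℕ} {i : Fin 2} {V : ℝ≥0∞}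
    (h : ∀ y ∈ PiNat.cylinder x n, y n = i →
      V ≤ ∏ m ∈ Finset.range n, ENNReal.ofReal (digitWeight (shift^[m] y))) :
    V * ENNReal.ofReal (1 / 5) ≤ thueMorseMeasure (PiNat.cylinder x n) := by
  have h1 := setLIntegral_cylinder x n (F := fun _ => 1) measurable_const
  rw [lintegral_indicator (measurableSet_cylinder _ _), setLIntegral_one] at h1
  rw [h1]
  refine (mul_le_mul_right (le_thueMorseMeasure_head i) V).trans ?_
  rw [← lintegral_indicator_const (measurableSet_head i)]
  refine lintegral_mono fun y => ?_
  by_cases hy : y 0 = i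
  · rw [Set.indicator_of_mem (by exact hy), mul_one]
    exact h _ (concatDigits_mem_cylinder x n y)
      (by rw [← hy]; exact concatDigits_apply_add x n 0 y)
  · rw [Set.indicator_of_notMem (by exact hy)]
    exact zero_le

/-! ### Sequences with prescribed blocks of zeros. -/

/-- The intervals `[p i, p i + k i + 1]` are nonempty in the interior, ordered and disjoint. -/
def IsBlockScheme (p k : ℕ → ℕ) : Prop := ∀ i, 1 ≤ k i ∧ p i + k i + 2 ≤ p (i + 1)

/-- Positions strictly inside one of the blocks; they carry the digit `0`. -/
def InBlock (p k : ℕ → ℕ) (m : ℕ) : Prop := ∃ i, p i < m ∧ m ≤ p i + k i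

/-- First and last positions of the blocks; they carry the digit `1`. -/
def OnBlockEnd (p k : ℕ → ℕ) (m : ℕ) : Prop := ∃ i, m = p i ∨ m = p i + k i + 1

/-- The positions with a prescribed digit: the blocks and the residues `0, 1` modulo `q`. -/
def IsForced (p k : ℕ → ℕ) (q m : ℕ) : Prop := InBlock p k m ∨ OnBlockEnd p k m ∨ m % q ≤ 1

open Classical in
/-- The prescribed digits. -/
def forcedDigit (p k : ℕ → ℕ) (q : ℕ) : BinSeq := fun m =>
  if OnBlockEnd p k m ∨ (¬ InBlock p k m ∧ m % q = 1) then 1 else 0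

/-- The sequences with long blocks of zeros in the blocks of a scheme, and with bounded runs
outside. -/
def blockSet (p k : ℕ → ℕ) (q : ℕ) : Set BinSeq :=
  {x | ∀ m, IsForced p k q m → x m = forcedDigit p k q m}

open Classical in
/-- The number of zeros from position `m` to the end of the block around `m`. -/
def blockRun (p k : ℕ → ℕ) (m : ℕ) : ℕ :=
  if h : InBlock p k m then p h.choose + k h.choose + 1 - m else 0

/-- Twice the sum of `blockRun` over the first `i` blocks. -/
def blockSum (k : ℕ → ℕ) (i : ℕ) : ℕ := ∑ j ∈ Finset.range i, k j * (k j + 1)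

section
variable {p k : ℕ → ℕ} {q : ℕ}

theorem IsBlockScheme.end_lt (h : IsBlockScheme p k) {i j : ℕ} (hij : i < j) :
    p i + k i + 2 ≤ p j := by
  induction j with
  | zero => omega
  | succ j ih =>
    have := h j
    rcases Nat.lt_succ_iff_lt_or_eq.1 hij with h1 | rfl
    · have := ih h1
      omega
    · exact this.2

theorem IsBlockScheme.strictMono (h : IsBlockScheme p k) : StrictMono p :=
  strictMono_nat_of_lt_succ fun i => by have := h i; omega

theorem IsBlockScheme.index_unique (h : IsBlockScheme p k) {i j m : ℕ}
    (hi : p i ≤ m ∧ m ≤ p i + k i + 1) (hj : p j ≤ m ∧ m ≤ p j + k j + 1) : i = j := by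
  rcases lt_trichotomy i j with h1 | h1 | h1
  · have := h.end_lt h1
    omega
  · exact h1
  · have := h.end_lt h1
    omega

theorem IsBlockScheme.not_onBlockEnd (h : IsBlockScheme p k) {m : ℕ} (hm : InBlock p k m) :
    ¬ OnBlockEnd p k m := by
  rintro ⟨j, hj⟩
  obtain ⟨i, hi⟩ := hm
  have := h.index_unique (i := i) (j := j) (m := m) (by omega) (by omega)
  subst this
  omega

theorem IsBlockScheme.blockRun_eq (h : IsBlockScheme p k) {i m : ℕ} (hm : p i < m ∧ m ≤ p i + k i) :
    blockRun p k m = p i + k i + 1 - m := by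
  have hb : InBlock p k m := ⟨i, hm⟩
  have hs := hb.choose_spec
  have : hb.choose = i := h.index_unique (m := m) (by omega) (by omega)
  rw [blockRun, dif_pos hb, this]

theorem blockRun_eq_zero {m : ℕ} (hm : ¬ InBlock p k m) : blockRun p k m = 0 := dif_neg hm

theorem IsBlockScheme.apply_eq_zero (h : IsBlockScheme p k) {x : BinSeq} (hx : x ∈ blockSet p k q)
    {m : ℕ} (hm : InBlock p k m) : x m = 0 := by
  rw [hx m (Or.inl hm), forcedDigit, if_neg]
  rintro (h1 | h1)
  · exact h.not_onBlockEnd hm h1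
  · exact h1.1 hm

theorem apply_blockEnd_eq_one {x : BinSeq} (hx : x ∈ blockSet p k q) {m : ℕ}
    (hm : OnBlockEnd p k m) : x m = 1 := by
  rw [hx m (Or.inr (Or.inl hm)), forcedDigit, if_pos (Or.inl hm)]

theorem IsBlockScheme.apply_eq_of_lt_blockRun (h : IsBlockScheme p k) {x : BinSeq}
    (hx : x ∈ blockSet p k q) {m j : ℕ} (hj : j < blockRun p k m) : x (m + j) = x m := by
  by_cases hm : InBlock p k m
  · rw [h.apply_eq_zero hx hm]
    obtain ⟨i, hi⟩ := hm
    rw [h.blockRun_eq hi] at hj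
    exact h.apply_eq_zero hx ⟨i, by omega, by omega⟩
  · rw [blockRun_eq_zero hm] at hj
    omega

/-- Outside the blocks, both digits occur in every window of length `q + 2`. -/
theorem IsBlockScheme.exists_digit_near (h : IsBlockScheme p k) (hq : 2 ≤ q) {x : BinSeq}
    (hx : x ∈ blockSet p k q) {m : ℕ} (hm : ∀ i, ¬ (p i < m ∧ m ≤ p i + k i + 1)) (a : Fin 2) :
    ∃ l ≤ q + 1, x (m + l) = a := by
  have hfin : ∀ a : Fin 2, a = 0 ∨ a = 1 := by decide
  -- If a block meets the window, it starts there, and its first two digits are 1 and 0. Otherwise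
  -- the window contains consecutive positions of residues 0 and 1 modulo `q`, undisturbed by
  -- blocks.
  by_cases hb : ∃ m', m ≤ m' ∧ m' ≤ m + q ∧ ∃ i, p i ≤ m' ∧ m' ≤ p i + k i + 1
  · obtain ⟨m', h1, h2, i, h3, h4⟩ := hb
    have h5 : m ≤ p i := by
      by_contra h6
      exact hm i ⟨by omega, by omega⟩
    have h7 := (h i).1
    rcases hfin a with rfl | rfl
    · refine ⟨p i + 1 - m, by omega, ?_⟩
      rw [show m + (p i + 1 - m) = p i + 1 by omega]
      exact h.apply_eq_zero hx ⟨i, by omega, by omega⟩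
    · refine ⟨p i - m, by omega, ?_⟩
      rw [show m + (p i - m) = p i by omega]
      exact apply_blockEnd_eq_one hx ⟨i, Or.inl rfl⟩
  · have hout : ∀ m', m ≤ m' → m' ≤ m + q → ¬ InBlock p k m' ∧ ¬ OnBlockEnd p k m' := by
      intro m' h1 h2
      constructor
      · rintro ⟨i, hi⟩
        exact hb ⟨m', h1, h2, i, by omega, by omega⟩
      · rintro ⟨i, hi⟩
        exact hb ⟨m', h1, h2, i, by omega, by omega⟩
    obtain ⟨d, hd, hmod⟩ : ∃ d, d < q ∧ (m + d) % q = 0 := by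
      have h1 := Nat.mod_lt m (show 0 < q by omega)
      have h2 := Nat.div_add_mod m q
      rcases Nat.eq_zero_or_pos (m % q) with h3 | h3
      · exact ⟨0, by omega, by simpa using h3⟩
      · refine ⟨q - m % q, by omega, ?_⟩
        rw [show m + (q - m % q) = q * (m / q + 1) by rw [mul_add]; omega]
        exact Nat.mul_mod_right _ _
    have hmod1 : (m + (d + 1)) % q = 1 := by
      rw [← add_assoc, Nat.add_mod, hmod, zero_add, Nat.mod_mod, Nat.mod_eq_of_lt (by omega)]
    rcases hfin a with rfl | rfl
    · refine ⟨d, by omega, ?_⟩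
      rw [hx _ (Or.inr (Or.inr (by omega))), forcedDigit, if_neg]
      rintro (h1 | h1)
      · exact (hout _ (by omega) (by omega)).2 h1
      · omega
    · refine ⟨d + 1, by omega, ?_⟩
      rw [hx _ (Or.inr (Or.inr (by omega))), forcedDigit, if_pos]
      exact Or.inr ⟨(hout _ (by omega) (by omega)).1, hmod1⟩

/-- Inside a block the closing 1 is at distance exactly `blockRun`. Elsewhere `exists_digit_near`
applies, after moving one place to the right at a closing 1; this shift turns `q + 1` into `q + 2`.
-/
theorem IsBlockScheme.exists_ne_near (h : IsBlockScheme p k) (hq : 2 ≤ q) {x : BinSeq}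
    (hx : x ∈ blockSet p k q) (m : ℕ) :
    ∃ l ≤ blockRun p k m + (q + 2), x (m + l) ≠ x m := by
  have hne : ∀ a : Fin 2, Fin.rev a ≠ a := by decide
  by_cases hb : ∃ i, p i < m ∧ m ≤ p i + k i + 1
  · obtain ⟨i, h1, h2⟩ := hb
    rcases Nat.lt_or_ge (p i + k i) m with h3 | h3
    · obtain ⟨l, hl, hxl⟩ := h.exists_digit_near hq hx (m := m + 1) (fun j hj => by
        have := h.index_unique (i := i) (j := j) (m := m) (by omega) (by omega)
        subst this
        omega) (Fin.rev (x m))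
      refine ⟨l + 1, by omega, ?_⟩
      rw [show m + (l + 1) = m + 1 + l by omega, hxl]
      exact hne _
    · refine ⟨p i + k i + 1 - m, by rw [h.blockRun_eq ⟨h1, h3⟩]; omega, ?_⟩
      rw [show m + (p i + k i + 1 - m) = p i + k i + 1 by omega,
        apply_blockEnd_eq_one hx ⟨i, Or.inr rfl⟩, h.apply_eq_zero hx ⟨i, h1, h3⟩]
      decide
  · obtain ⟨l, hl, hxl⟩ := h.exists_digit_near hq hx (fun i hi => hb ⟨i, hi⟩) (Fin.rev (x m))
    exact ⟨l, by omega, by rw [hxl]; exact hne _⟩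

/-- The triangular sum `k + ⋯ + 1`, padded by `L` further terms that vanish by truncated
subtraction. -/
theorem two_mul_sum_block (k L : ℕ) (f : ℕ → ℕ) (h0 : f 0 = 0)
    (h1 : ∀ m, 1 ≤ m → f m = k + 1 - m) :
    2 * ∑ m ∈ Finset.range (k + 1 + L), f m = k * (k + 1) := by
  induction L with
  | zero =>
    rw [add_zero, Finset.sum_range_succ', h0, add_zero, ← Finset.sum_range_reflect,
      mul_comm, mul_comm k]
    rw [show ∑ j ∈ Finset.range k, f (k - 1 - j + 1) = ∑ j ∈ Finset.range k, (j + 1) from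
      Finset.sum_congr rfl fun j hj => by
        have := Finset.mem_range.1 hj
        rw [h1 _ (by omega)]
        omega]
    have := Finset.sum_range_id_mul_two (k + 1)
    rw [Finset.sum_range_succ'] at this
    simpa using this
  | succ L ih =>
    rw [← add_assoc, Finset.sum_range_succ, h1 _ (by omega)]
    omega

theorem IsBlockScheme.two_mul_sum_blockRun (h : IsBlockScheme p k) (i : ℕ) :
    2 * ∑ m ∈ Finset.range (p i), blockRun p k m = blockSum k i := by
  induction i with
  | zero =>
    rw [Finset.sum_eq_zero]
    · simp [blockSum]
    · intro m hm
      refine blockRun_eq_zero ?_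
      rintro ⟨i, hi⟩
      have := h.strictMono.monotone (Nat.zero_le i)
      have := Finset.mem_range.1 hm
      omega
  | succ i ih =>
    have h2 := (h i).2
    obtain ⟨L, hL⟩ : ∃ L, p (i + 1) = p i + (k i + 1 + L) :=
      ⟨p (i + 1) - (p i + k i + 1), by omega⟩
    have h3 : 2 * ∑ m ∈ Finset.range (k i + 1 + L), blockRun p k (p i + m) = k i * (k i + 1) := by
      rw [← two_mul_sum_block (k i) L (fun m => if m = 0 then 0 else k i + 1 - m) (by simp)
        (fun m hm => by rw [if_neg (by omega)])]
      congr 1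
      refine Finset.sum_congr rfl fun m hm => ?_
      have hm' := Finset.mem_range.1 hm
      by_cases hb : 1 ≤ m ∧ m ≤ k i
      · rw [h.blockRun_eq (i := i) (by omega), if_neg (by omega)]
        omega
      · rw [blockRun_eq_zero]
        · split_ifs <;> omega
        · rintro ⟨j, hj⟩
          rcases lt_trichotomy j i with h4 | rfl | h4
          · have := h.end_lt h4
            omega
          · omega
          · have := h.strictMono.monotone (show i + 1 ≤ j from h4)
            omega
    rw [hL, Finset.sum_range_add, mul_add, ih, h3, blockSum, blockSum, Finset.sum_range_succ]

/-- Only blocks completed before `p i` are counted. They lie inside the prefix of length `n`, hence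
are shared by every `y` in the cylinder; all other positions get the trivial bound `π²`. -/
theorem IsBlockScheme.prod_digitWeight_le (h : IsBlockScheme p k) {x y : BinSeq}
    (hx : x ∈ blockSet p k q) {n i : ℕ} (hy : y ∈ PiNat.cylinder x n) (hn : p i ≤ n) :
    ∏ m ∈ Finset.range n, digitWeight (shift^[m] y)
      ≤ (Real.pi ^ 2) ^ n * (1 / 2) ^ blockSum k i := by
  have hle : ∀ m ∈ Finset.range n, digitWeight (shift^[m] y)
      ≤ Real.pi ^ 2 * (1 / 4) ^ (if m < p i then blockRun p k m else 0) := by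
    intro m hm
    have hm' := Finset.mem_range.1 hm
    refine digitWeight_shift_le_of_run fun j hj => ?_
    split_ifs at hj with h1
    · have h2 : m + blockRun p k m ≤ n := by
        by_cases hb : InBlock p k m
        · obtain ⟨l, hl⟩ := hb
          have h3 : l < i := h.strictMono.lt_iff_lt.1 (by omega)
          have := h.end_lt h3
          rw [h.blockRun_eq hl]
          omega
        · rw [blockRun_eq_zero hb]
          omega
      rw [hy m (by omega), hy (m + j) (by omega)]
      exact h.apply_eq_of_lt_blockRun hx hj
    · omega
  refine (Finset.prod_le_prod (fun m _ => digitWeight_nonneg _) hle).trans_eq ?_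
  rw [Finset.prod_mul_distrib, Finset.prod_const, Finset.card_range, Finset.prod_pow_eq_pow_sum,
    ← h.two_mul_sum_blockRun, pow_mul]
  congr 2
  · norm_num
  · obtain ⟨L, rfl⟩ := Nat.exists_eq_add_of_le hn
    rw [Finset.sum_range_add, Finset.sum_eq_zero (s := Finset.range L), add_zero]
    · exact Finset.sum_congr rfl fun m hm => if_pos (Finset.mem_range.1 hm)
    · exact fun m _ => if_neg (by omega)

/-- Here all blocks before `p i ≥ n` are charged, including one that `n` may cut. The hypothesis
concerns `y` alone, so that it serves both for `y = x` and for the points of a cylinder. -/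
theorem IsBlockScheme.le_prod_digitWeight (h : IsBlockScheme p k) {y : BinSeq} {n i c : ℕ}
    (hy : ∀ m < n, ∃ l ≤ blockRun p k m + c, y (m + l) ≠ y m) (hn : n ≤ p i) :
    ((1 / 4) ^ c) ^ n * (1 / 2) ^ blockSum k i
      ≤ ∏ m ∈ Finset.range n, digitWeight (shift^[m] y) := by
  have hle : ∀ m ∈ Finset.range n, (1 / 4) ^ c * (1 / 4) ^ blockRun p k m
      ≤ digitWeight (shift^[m] y) := by
    intro m hm
    obtain ⟨l, hl, hne⟩ := hy m (Finset.mem_range.1 hm)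
    refine le_trans ?_ (le_digitWeight_shift_of_ne hne)
    rw [← pow_add]
    exact pow_le_pow_of_le_one (by norm_num) (by norm_num) (by omega)
  refine le_trans ?_ (Finset.prod_le_prod (fun m _ => by positivity) hle)
  rw [Finset.prod_mul_distrib, Finset.prod_const, Finset.card_range, Finset.prod_pow_eq_pow_sum,
    ← h.two_mul_sum_blockRun, pow_mul]
  refine mul_le_mul_of_nonneg_left ?_ (by positivity)
  rw [show ((1 / 2 : ℝ) ^ 2) = 1 / 4 by norm_num]
  exact pow_le_pow_of_le_one (by norm_num) (by norm_num)
    (Finset.sum_le_sum_of_subset (Finset.range_mono hn))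

/-- A change of digit in `x` within the prefix is inherited by `y`. If it comes later, positions `n
- 1` and `n` of `y` carry different digits, so one of them differs from `y m`, and no later than the
change in `x`. -/
theorem IsBlockScheme.exists_ne_of_mem_cylinder (h : IsBlockScheme p k) (hq : 2 ≤ q)
    {x y : BinSeq} (hx : x ∈ blockSet p k q) {n : ℕ} (hy : y ∈ PiNat.cylinder x n)
    (hyn : y n = Fin.rev (x (n - 1))) {m : ℕ} (hm : m < n) :
    ∃ l ≤ blockRun p k m + (q + 2), y (m + l) ≠ y m := by
  have hne : ∀ a : Fin 2, Fin.rev a ≠ a := by decide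
  obtain ⟨l, hl, hxl⟩ := h.exists_ne_near hq hx m
  by_cases hml : m + l < n
  · exact ⟨l, hl, by rw [hy _ hml, hy _ hm]; exact hxl⟩
  · by_cases h1 : y n = y m
    · have hm1 : m ≠ n - 1 := by
        rintro rfl
        rw [hyn, hy _ hm] at h1
        exact hne _ h1
      refine ⟨n - 1 - m, by omega, ?_⟩
      rw [show m + (n - 1 - m) = n - 1 by omega, ← h1, hyn, hy _ (by omega)]
      exact (hne _).symm
    · exact ⟨n - m, by omega, by rwa [show m + (n - m) = n by omega]⟩

/-- Blocks meeting `[0, n)` have index at most `i` and occupy `k j + 2` positions each, both ends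
included. The residues contribute two positions per period. -/
theorem count_isForced_le (h : IsBlockScheme p k) [DecidablePred (IsForced p k q)]
    {n i : ℕ} (hn : n ≤ p (i + 1)) :
    Nat.count (IsForced p k q) n
      ≤ ∑ j ∈ Finset.range (i + 1), (k j + 2) + (n / q + 1) * 2 := by
  classical
  rw [Nat.count_eq_card_filter_range]
  have hsub : Finset.filter (IsForced p k q) (Finset.range n) ⊆
      ((Finset.range (i + 1)).biUnion fun j => Finset.Ico (p j) (p j + (k j + 2))) ∪
      (Finset.range (n / q + 1) ×ˢ Finset.range 2).image fun a => q * a.1 + a.2 := by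
    intro m hm
    obtain ⟨h1, h2⟩ := Finset.mem_filter.1 hm
    have h1' := Finset.mem_range.1 h1
    rw [Finset.mem_union, Finset.mem_biUnion, Finset.mem_image]
    have hblock : (∃ j, p j ≤ m ∧ m ≤ p j + k j + 1) →
        ∃ a ∈ Finset.range (i + 1), m ∈ Finset.Ico (p a) (p a + (k a + 2)) := by
      rintro ⟨j, hj⟩
      refine ⟨j, Finset.mem_range.2 (h.strictMono.lt_iff_lt.1 (by omega)), ?_⟩
      rw [Finset.mem_Ico]
      omega
    rcases h2 with ⟨j, hj⟩ | ⟨j, hj⟩ | h2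
    · exact Or.inl (hblock ⟨j, by omega⟩)
    · exact Or.inl (hblock ⟨j, by omega⟩)
    · refine Or.inr ⟨(m / q, m % q), ?_, Nat.div_add_mod m q⟩
      rw [Finset.mem_product, Finset.mem_range, Finset.mem_range]
      exact ⟨Nat.lt_succ_of_le (Nat.div_le_div_right h1'.le), by simp only; omega⟩
  refine (Finset.card_le_card hsub).trans ((Finset.card_union_le _ _).trans ?_)
  refine add_le_add (Finset.card_biUnion_le.trans_eq ?_) (Finset.card_image_le.trans_eq ?_)
  · simp
  · simp
end

/-! ### Choice of the block lengths and positions. -/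

theorem tendsto_rpow_div_rpow {a b : ℝ} (h : a < b) :
    Tendsto (fun y : ℝ => y ^ a / y ^ b) atTop (𝓝 0) := by
  refine (tendsto_rpow_neg_atTop (sub_pos.2 h)).congr' ?_
  filter_upwards [eventually_gt_atTop 0] with y hy
  rw [← Real.rpow_sub hy]
  congr 1
  ring

theorem rpow_add_one_sub_le {y β : ℝ} (hy : 0 ≤ y) (hβ : 1 ≤ β) :
    (y + 1) ^ β - y ^ β ≤ β * (y + 1) ^ (β - 1) := by
  have hy1 : 0 < y + 1 := by linarith
  have h1 : (-1 : ℝ) ≤ -(1 / (y + 1)) := by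
    rw [neg_le_neg_iff, div_le_one hy1]
    linarith
  -- Bernoulli's inequality for `(y / (y + 1)) ^ β = (1 - 1 / (y + 1)) ^ β`.
  have h2 := one_add_mul_self_le_rpow_one_add h1 hβ
  have h3 : 1 + -(1 / (y + 1)) = y / (y + 1) := by
    field_simp
    ring
  rw [h3, Real.div_rpow hy hy1.le, le_div_iff₀ (Real.rpow_pos_of_pos hy1 β)] at h2
  rw [Real.rpow_sub_one hy1.ne']
  have h4 : (1 + β * -(1 / (y + 1))) * (y + 1) ^ β = (y + 1) ^ β - β * ((y + 1) ^ β / (y + 1)) := by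
    ring
  linarith

/-- The block lengths for which the sums of `k (k + 1)` grow like `α y ^ β`. -/
def blockLength (α β : ℝ) (y : ℕ) : ℕ := ⌊√(α * (((y : ℝ) + 1) ^ β - (y : ℝ) ^ β))⌋₊ + 1

theorem sqrt_increment_le {α β y : ℝ} (hα : 0 ≤ α) (hβ : 1 ≤ β) (hy : 0 ≤ y) :
    √(α * ((y + 1) ^ β - y ^ β)) ≤ √(α * β) * (y + 1) ^ ((β - 1) / 2) := by
  have h1 : α * ((y + 1) ^ β - y ^ β) ≤ α * β * (y + 1) ^ (β - 1) := by
    rw [mul_assoc]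
    exact mul_le_mul_of_nonneg_left (rpow_add_one_sub_le hy hβ) hα
  refine (Real.sqrt_le_sqrt h1).trans_eq ?_
  rw [Real.sqrt_mul (by positivity), Real.sqrt_eq_rpow ((y + 1) ^ (β - 1)),
    ← Real.rpow_mul (by linarith)]
  congr 2
  ring

theorem blockLength_le {α β : ℝ} (hα : 0 ≤ α) (hβ : 1 ≤ β) (y : ℕ) :
    (blockLength α β y : ℝ) ≤ √(α * β) * ((y : ℝ) + 1) ^ ((β - 1) / 2) + 1 := by
  unfold blockLength
  push_cast
  exact add_le_add_left ((Nat.floor_le (Real.sqrt_nonneg _)).trans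
    (sqrt_increment_le hα hβ (Nat.cast_nonneg y))) 1

/-- With `s` the square root in `blockLength`, the length `k` satisfies `s ≤ k ≤ s + 1`, so `s² ≤
k(k+1) ≤ (s+1)(s+2) = s² + 3s + 2`. -/
theorem blockLength_sq_bounds {α β : ℝ} (hα : 0 ≤ α) (hβ : 1 ≤ β) (y : ℕ) :
    α * (((y : ℝ) + 1) ^ β - (y : ℝ) ^ β) ≤ (blockLength α β y : ℝ) * (blockLength α β y + 1) ∧
    (blockLength α β y : ℝ) * (blockLength α β y + 1) ≤ α * (((y : ℝ) + 1) ^ β - (y : ℝ) ^ β)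
      + (3 * (√(α * β) * ((y : ℝ) + 1) ^ ((β - 1) / 2)) + 2) := by
  have hle := sqrt_increment_le hα hβ (Nat.cast_nonneg (α := ℝ) y)
  have hnn : 0 ≤ α * (((y : ℝ) + 1) ^ β - (y : ℝ) ^ β) :=
    mul_nonneg hα (sub_nonneg.2 (Real.rpow_le_rpow (by positivity) (by linarith) (by linarith)))
  have hsq := Real.mul_self_sqrt hnn
  unfold blockLength
  set s := √(α * (((y : ℝ) + 1) ^ β - (y : ℝ) ^ β)) with hs
  have hs0 : 0 ≤ s := Real.sqrt_nonneg _
  have h1 := Nat.floor_le hs0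
  have h2 := Nat.lt_floor_add_one s
  push_cast
  rw [← hsq]
  constructor <;> nlinarith

theorem tendsto_natCast_add_atTop (i₀ : ℕ) :
    Tendsto (fun i : ℕ => ((i + i₀ : ℕ) : ℝ)) atTop atTop :=
  tendsto_natCast_atTop_atTop.comp (tendsto_add_atTop_nat i₀)

/-- The main terms telescope to `α ((i + i₀)^β - i₀^β)`. The errors add up to `O((i +
i₀)^{(β+1)/2})`, which is of lower order because `β > 1`. -/
theorem tendsto_blockSum_div {α β : ℝ} (hα : 0 ≤ α) (hβ : 1 < β) (i₀ : ℕ) :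
    Tendsto (fun i : ℕ => (blockSum (fun i => blockLength α β (i + i₀)) i : ℝ)
      / ((i + i₀ : ℕ) : ℝ) ^ β) atTop (𝓝 α) := by
  set e := (β - 1) / 2 with he
  set K := √(α * β) with hK
  have hK0 : 0 ≤ K := Real.sqrt_nonneg _
  have hb : ∀ i : ℕ, α * (((i + i₀ : ℕ) : ℝ) ^ β - (i₀ : ℝ) ^ β)
        ≤ (blockSum (fun i => blockLength α β (i + i₀)) i : ℝ) ∧
      (blockSum (fun i => blockLength α β (i + i₀)) i : ℝ)
        ≤ α * (((i + i₀ : ℕ) : ℝ) ^ β - (i₀ : ℝ) ^ β)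
          + i * (3 * (K * ((i + i₀ : ℕ) : ℝ) ^ e) + 2) := by
    intro i
    induction i with
    | zero => simp [blockSum]
    | succ i ih =>
      have h1 := blockLength_sq_bounds hα hβ.le (i + i₀)
      have h2 : (blockSum (fun i => blockLength α β (i + i₀)) (i + 1) : ℝ)
          = blockSum (fun i => blockLength α β (i + i₀)) i
            + (blockLength α β (i + i₀) : ℝ) * (blockLength α β (i + i₀) + 1) := by
        simp only [blockSum]
        rw [Finset.sum_range_succ]
        push_cast
        rfl
      have h3 : ((i + 1 + i₀ : ℕ) : ℝ) = ((i + i₀ : ℕ) : ℝ) + 1 := by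
        push_cast
        ring
      have h4 : ((i + i₀ : ℕ) : ℝ) ^ e ≤ (((i + i₀ : ℕ) : ℝ) + 1) ^ e :=
        Real.rpow_le_rpow (by positivity) (by linarith) (by rw [he]; linarith)
      have h5 : (i : ℝ) * (3 * (K * ((i + i₀ : ℕ) : ℝ) ^ e) + 2)
          ≤ i * (3 * (K * (((i + i₀ : ℕ) : ℝ) + 1) ^ e) + 2) := by gcongr
      rw [h2, h3]
      push_cast at *
      constructor
      · linarith [h1.1, ih.1]
      · linarith [h1.2, ih.2]
  have hc := tendsto_natCast_add_atTop i₀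
  have hlow : Tendsto (fun i : ℕ => α - α * (i₀ : ℝ) ^ β
      * (((i + i₀ : ℕ) : ℝ) ^ (0 : ℝ) / ((i + i₀ : ℕ) : ℝ) ^ β)) atTop (𝓝 α) := by
    have := ((tendsto_rpow_div_rpow (a := 0) (b := β) (by linarith)).comp hc).const_mul
      (α * (i₀ : ℝ) ^ β)
    simpa using this.const_sub α
  have hup : Tendsto (fun i : ℕ => α + (3 * K
      * (((i + i₀ : ℕ) : ℝ) ^ (e + 1) / ((i + i₀ : ℕ) : ℝ) ^ β)
      + 2 * (((i + i₀ : ℕ) : ℝ) ^ (1 : ℝ) / ((i + i₀ : ℕ) : ℝ) ^ β))) atTop (𝓝 α) := by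
    have h1 := ((tendsto_rpow_div_rpow (a := e + 1) (b := β) (by rw [he]; linarith)).comp hc).const_mul
      (3 * K)
    have h2 := ((tendsto_rpow_div_rpow (a := 1) (b := β) hβ).comp hc).const_mul 2
    simpa using (h1.add h2).const_add α
  refine tendsto_of_tendsto_of_tendsto_of_le_of_le' hlow hup ?_ ?_
  · filter_upwards [hc.eventually (eventually_gt_atTop 0)] with i hi
    have hpos := Real.rpow_pos_of_pos hi β
    rw [le_div_iff₀ hpos, Real.rpow_zero]
    refine le_trans (le_of_eq ?_) (hb i).1
    field_simp
  · filter_upwards [hc.eventually (eventually_gt_atTop 0)] with i hi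
    have hpos := Real.rpow_pos_of_pos hi β
    rw [div_le_iff₀ hpos]
    refine (hb i).2.trans ?_
    have h1 : (i : ℝ) ≤ ((i + i₀ : ℕ) : ℝ) := by
      push_cast
      linarith [Nat.cast_nonneg (α := ℝ) i₀]
    have h2 : 0 ≤ α * (i₀ : ℝ) ^ β := by positivity
    have h3 : 0 ≤ 3 * (K * ((i + i₀ : ℕ) : ℝ) ^ e) + 2 := by positivity
    have h4 : (α + (3 * K * (((i + i₀ : ℕ) : ℝ) ^ (e + 1) / ((i + i₀ : ℕ) : ℝ) ^ β)
        + 2 * (((i + i₀ : ℕ) : ℝ) ^ (1 : ℝ) / ((i + i₀ : ℕ) : ℝ) ^ β))) * ((i + i₀ : ℕ) : ℝ) ^ β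
        = α * ((i + i₀ : ℕ) : ℝ) ^ β
          + ((i + i₀ : ℕ) : ℝ) * (3 * (K * ((i + i₀ : ℕ) : ℝ) ^ e) + 2) := by
      rw [Real.rpow_add_one hi.ne', Real.rpow_one]
      field_simp
    rw [h4]
    nlinarith [mul_le_mul_of_nonneg_right h1 h3]

theorem tendsto_natCast_succ_div_pow (i₀ N : ℕ) :
    Tendsto (fun i : ℕ => (((i + 1 + i₀) ^ N : ℕ) : ℝ) / (((i + i₀) ^ N : ℕ) : ℝ)) atTop (𝓝 1) := by
  have hc := tendsto_natCast_add_atTop i₀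
  have h1 : Tendsto (fun i : ℕ => (1 + (((i + i₀ : ℕ) : ℝ))⁻¹) ^ N) atTop (𝓝 1) := by
    simpa using ((tendsto_inv_atTop_zero.comp hc).const_add 1).pow N
  refine h1.congr' ?_
  filter_upwards [hc.eventually (eventually_gt_atTop 0)] with i hi
  rw [Nat.cast_pow, Nat.cast_pow, ← div_pow]
  congr 1
  rw [show ((i + 1 + i₀ : ℕ) : ℝ) = ((i + i₀ : ℕ) : ℝ) + 1 by push_cast; ring, add_div,
    div_self hi.ne', one_div]

/-- Block schemes of density zero for which `blockSum k i` grows like `α (p i) ^ γ`. -/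
theorem exists_isBlockScheme {γ α : ℝ} (hγ : γ ∈ Set.Ioo (1 : ℝ) 2) (hα : 0 ≤ α) :
    ∃ p k : ℕ → ℕ, IsBlockScheme p k ∧ 1 ≤ p 0 ∧
      Tendsto (fun i => (blockSum k i : ℝ) / (p i : ℝ) ^ γ) atTop (𝓝 α) ∧
      Tendsto (fun i => (p (i + 1) : ℝ) / (p i : ℝ)) atTop (𝓝 1) ∧
      Tendsto (fun i => (∑ j ∈ Finset.range (i + 1), (k j + 2) : ℕ) / (p i : ℝ)) atTop (𝓝 0) := by
  obtain ⟨hγ1, hγ2⟩ := hγ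
  -- With `β = N γ`, the block lengths add up to order at most `i^{(β+1)/2}`. This is `o(i^N)`
  -- exactly when `N (2 - γ) > 1`.
  obtain ⟨N, hN⟩ := exists_nat_gt (1 / (2 - γ))
  rw [div_lt_iff₀ (by linarith)] at hN
  have hN1 : (1 : ℝ) < N := by nlinarith [Nat.cast_nonneg (α := ℝ) N]
  set β := N * γ with hβdef
  have hβ : 1 < β := by nlinarith
  set e := (β - 1) / 2 with he
  have he0 : 0 < e := by rw [he]; linarith
  have heN : e + 1 < N := by rw [he]; linarith
  set K := √(α * β) with hK
  have hK0 : 0 ≤ K := Real.sqrt_nonneg _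
  have htwo : ∀ y : ℝ, 1 ≤ y → (y + 1) ^ e ≤ 2 ^ e * y ^ e := fun y hy => by
    rw [← Real.mul_rpow (by norm_num) (by linarith)]
    exact Real.rpow_le_rpow (by linarith) (by linarith) he0.le
  -- Room for the blocks: the gap `(y + 1)^N - y^N` is at least `y^{N-1}`, which eventually exceeds
  -- block length plus 2. The offset `i₀` starts the scheme beyond this threshold.
  have hev : ∀ᶠ y : ℝ in atTop, K * 2 ^ e * y ^ e + 3 ≤ y ^ ((N : ℝ) - 1) := by
    have h1 : Tendsto (fun y : ℝ => K * 2 ^ e * (y ^ e / y ^ ((N : ℝ) - 1))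
        + 3 * (y ^ (0 : ℝ) / y ^ ((N : ℝ) - 1))) atTop (𝓝 0) := by
      have h2 := (tendsto_rpow_div_rpow (a := e) (b := (N : ℝ) - 1) (by linarith)).const_mul
        (K * 2 ^ e)
      have h3 := (tendsto_rpow_div_rpow (a := 0) (b := (N : ℝ) - 1) (by linarith)).const_mul 3
      simpa using h2.add h3
    filter_upwards [h1.eventually (gt_mem_nhds one_pos), eventually_gt_atTop 0] with y hy hy0
    have hpos := Real.rpow_pos_of_pos hy0 ((N : ℝ) - 1)
    rw [Real.rpow_zero, ← mul_div_assoc, ← mul_div_assoc, ← add_div, div_lt_one hpos] at hy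
    linarith
  obtain ⟨i₀, hi₀⟩ := eventually_atTop.1
    (tendsto_natCast_atTop_atTop.eventually (hev.and (eventually_ge_atTop (1 : ℝ))))
  have hc := tendsto_natCast_add_atTop i₀
  have hone : ∀ i : ℕ, (1 : ℝ) ≤ ((i + i₀ : ℕ) : ℝ) := fun i => (hi₀ (i + i₀) (by omega)).2
  have hklen : ∀ i : ℕ, (blockLength α β (i + i₀) : ℝ)
      ≤ K * 2 ^ e * ((i + i₀ : ℕ) : ℝ) ^ e + 1 := fun i => by
    refine (blockLength_le hα hβ.le _).trans ?_
    rw [mul_assoc]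
    exact add_le_add_left (mul_le_mul_of_nonneg_left (htwo _ (hone i)) hK0) 1
  refine ⟨fun i => (i + i₀) ^ N, fun i => blockLength α β (i + i₀), ?_, ?_, ?_,
    tendsto_natCast_succ_div_pow i₀ N, ?_⟩
  · intro i
    refine ⟨Nat.succ_le_succ (Nat.zero_le _), ?_⟩
    have h1 := (hi₀ (i + i₀) (by omega)).1
    have h2 := hklen i
    have hy := hone i
    have h3 : ((i + 1 + i₀ : ℕ) : ℝ) = ((i + i₀ : ℕ) : ℝ) + 1 := by
      push_cast
      ring
    have h4 : ((i + i₀ : ℕ) : ℝ) ^ N + ((i + i₀ : ℕ) : ℝ) ^ ((N : ℝ) - 1)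
        ≤ (((i + i₀ : ℕ) : ℝ) + 1) ^ N := by
      obtain ⟨M, rfl⟩ : ∃ M, N = M + 1 := ⟨N - 1, by
        have : 1 < N := by exact_mod_cast hN1
        omega⟩
      rw [Nat.cast_succ, add_sub_cancel_right, Real.rpow_natCast, pow_succ, pow_succ]
      have : ((i + i₀ : ℕ) : ℝ) ^ M ≤ (((i + i₀ : ℕ) : ℝ) + 1) ^ M :=
        pow_le_pow_left₀ (by linarith) (by linarith) M
      nlinarith
    have h5 : (((i + i₀) ^ N + blockLength α β (i + i₀) + 2 : ℕ) : ℝ)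
        ≤ (((i + 1 + i₀) ^ N : ℕ) : ℝ) := by
      rw [Nat.cast_pow, h3, Nat.cast_add, Nat.cast_add, Nat.cast_pow]
      push_cast at *
      linarith
    exact_mod_cast h5
  · have : 1 ≤ i₀ := by simpa using hone 0
    simpa using Nat.one_le_pow _ _ this
  · have h1 := tendsto_blockSum_div hα hβ i₀
    refine h1.congr fun i => ?_
    rw [hβdef, Real.rpow_mul (by positivity), Real.rpow_natCast, Nat.cast_pow]
  · have hb : ∀ i : ℕ, ((∑ j ∈ Finset.range (i + 1), (blockLength α β (j + i₀) + 2) : ℕ) : ℝ)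
        ≤ 2 * (((i + i₀ : ℕ) : ℝ) * (K * 2 ^ e * ((i + i₀ : ℕ) : ℝ) ^ e + 3)) := by
      intro i
      have h1 : ∀ j ∈ Finset.range (i + 1), ((blockLength α β (j + i₀) + 2 : ℕ) : ℝ)
          ≤ K * 2 ^ e * ((i + i₀ : ℕ) : ℝ) ^ e + 3 := by
        intro j hj
        have h2 := hklen j
        have h3 : ((j + i₀ : ℕ) : ℝ) ^ e ≤ ((i + i₀ : ℕ) : ℝ) ^ e := by
          refine Real.rpow_le_rpow (by positivity) ?_ he0.le
          have := Finset.mem_range.1 hj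
          exact_mod_cast (by omega : j + i₀ ≤ i + i₀)
        have h4 : K * 2 ^ e * ((j + i₀ : ℕ) : ℝ) ^ e ≤ K * 2 ^ e * ((i + i₀ : ℕ) : ℝ) ^ e := by
          gcongr
        push_cast at *
        linarith
      rw [Nat.cast_sum]
      refine (Finset.sum_le_card_nsmul _ _ _ h1).trans ?_
      rw [Finset.card_range, nsmul_eq_mul, ← mul_assoc]
      refine mul_le_mul_of_nonneg_right ?_ (by positivity)
      have := hone i
      push_cast at *
      linarith [Nat.cast_nonneg (α := ℝ) i₀]
    have hup : Tendsto (fun i : ℕ => 2 * (K * 2 ^ e)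
        * (((i + i₀ : ℕ) : ℝ) ^ (e + 1) / ((i + i₀ : ℕ) : ℝ) ^ (N : ℝ))
        + 6 * (((i + i₀ : ℕ) : ℝ) ^ (1 : ℝ) / ((i + i₀ : ℕ) : ℝ) ^ (N : ℝ))) atTop (𝓝 0) := by
      have h1 := ((tendsto_rpow_div_rpow heN).comp hc).const_mul (2 * (K * 2 ^ e))
      have h2 := ((tendsto_rpow_div_rpow hN1).comp hc).const_mul 6
      simpa using h1.add h2
    refine squeeze_zero (fun i => by positivity) (fun i => ?_) hup
    have hy := hone i
    have hpos : 0 < ((i + i₀ : ℕ) : ℝ) ^ N := pow_pos (by linarith) N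
    rw [Nat.cast_pow, div_le_iff₀ hpos]
    refine (hb i).trans_eq ?_
    rw [Real.rpow_add_one (by linarith), Real.rpow_one, Real.rpow_natCast]
    field_simp
    ring

/-! ### From block positions to all `n`. -/

theorem StrictMono.exists_between_succ {p : ℕ → ℕ} (hp : StrictMono p) {n : ℕ} (hn : p 0 ≤ n) :
    ∃ i, p i ≤ n ∧ n < p (i + 1) := by
  refine ⟨Nat.findGreatest (fun i => p i ≤ n) n,
    Nat.findGreatest_spec (P := fun i => p i ≤ n) (Nat.zero_le n) hn, ?_⟩
  by_contra! h
  have h2 := Nat.le_findGreatest (P := fun i => p i ≤ n) (hp.le_apply.trans h) h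
  omega

/-- A sequence squeezed between consecutive block sums has the growth rate of the block sums. -/
theorem tendsto_of_blockSum_bounds {p : ℕ → ℕ} {D : ℕ → ℝ} {γ α L c : ℝ} (hγ : 1 < γ) (hL : 0 < L)
    (hp : StrictMono p) (hp0 : 1 ≤ p 0) (hD0 : ∀ i, 0 ≤ D i)
    (hD : Tendsto (fun i => D i / (p i : ℝ) ^ γ) atTop (𝓝 α))
    (hr : Tendsto (fun i => (p (i + 1) : ℝ) / (p i : ℝ)) atTop (𝓝 1)) {v : ℕ → ℝ}
    (hv : ∀ n i, p i ≤ n → n ≤ p (i + 1) → D i * L - c * n ≤ v n ∧ v n ≤ D (i + 1) * L + c * n) :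
    Tendsto (fun n : ℕ => v n / ((n : ℝ) ^ γ * L)) atTop (𝓝 α) := by
  have hpos : ∀ i, (0 : ℝ) < p i := fun i => by
    have := hp.monotone (Nat.zero_le i)
    exact_mod_cast (by omega : 0 < p i)
  -- Since consecutive positions have ratio tending to 1, `p i` and `p (i + 1)` are interchangeable
  -- in the normalization.
  have hrγ : Tendsto (fun i => ((p (i + 1) : ℝ) / (p i : ℝ)) ^ γ) atTop (𝓝 1) := by
    simpa using hr.rpow_const (p := γ) (Or.inl one_ne_zero)
  have hlow : Tendsto (fun i => D i / (p (i + 1) : ℝ) ^ γ) atTop (𝓝 α) := by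
    have h1 := hD.div hrγ one_ne_zero
    rw [div_one] at h1
    refine h1.congr fun i => ?_
    have h2 := Real.rpow_pos_of_pos (hpos i) γ
    have h3 := Real.rpow_pos_of_pos (hpos (i + 1)) γ
    simp only [Pi.div_apply]
    rw [Real.div_rpow (hpos _).le (hpos _).le]
    field_simp
  have hup : Tendsto (fun i => D (i + 1) / (p i : ℝ) ^ γ) atTop (𝓝 α) := by
    have h1 := (hD.comp (tendsto_add_atTop_nat 1)).mul hrγ
    rw [mul_one] at h1
    refine h1.congr fun i => ?_
    have h2 := Real.rpow_pos_of_pos (hpos i) γ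
    have h3 := Real.rpow_pos_of_pos (hpos (i + 1)) γ
    simp only [Function.comp_apply]
    rw [Real.div_rpow (hpos _).le (hpos _).le]
    field_simp
  have hex : ∀ n, ∃ i, p 0 ≤ n → p i ≤ n ∧ n < p (i + 1) := fun n => by
    by_cases hn : p 0 ≤ n
    · obtain ⟨i, hi⟩ := hp.exists_between_succ hn
      exact ⟨i, fun _ => hi⟩
    · exact ⟨0, fun h => absurd h hn⟩
  choose ι hι using hex
  have hιtop : Tendsto ι atTop atTop := by
    refine tendsto_atTop.2 fun b => ?_
    filter_upwards [eventually_ge_atTop (p b)] with n hn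
    have h1 := (hι n ((hp.monotone (Nat.zero_le b)).trans hn)).2
    exact Nat.lt_succ_iff.1 (hp.lt_iff_lt.1 (hn.trans_lt h1))
  -- The linear error disappears because `γ > 1`.
  have hlin : Tendsto (fun n : ℕ => c / L * ((n : ℝ) ^ (1 : ℝ) / (n : ℝ) ^ γ)) atTop (𝓝 0) := by
    simpa using ((tendsto_rpow_div_rpow hγ).comp tendsto_natCast_atTop_atTop).const_mul (c / L)
  have hlow' := (hlow.comp hιtop).sub hlin
  have hup' := (hup.comp hιtop).add hlin
  rw [sub_zero] at hlow'
  rw [add_zero] at hup'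
  have hlineq : ∀ n : ℕ, 0 < (n : ℝ) →
      c / L * ((n : ℝ) ^ (1 : ℝ) / (n : ℝ) ^ γ) = c * n / ((n : ℝ) ^ γ * L) := fun n hn => by
    rw [Real.rpow_one]
    have := Real.rpow_pos_of_pos hn γ
    field_simp
  have hDeq : ∀ (d : ℝ) (n : ℕ), d / (n : ℝ) ^ γ = d * L / ((n : ℝ) ^ γ * L) := fun d n =>
    (mul_div_mul_right _ _ hL.ne').symm
  refine tendsto_of_tendsto_of_tendsto_of_le_of_le' hlow' hup' ?_ ?_
  · filter_upwards [eventually_ge_atTop (p 0)] with n hn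
    obtain ⟨h1, h2⟩ := hι n hn
    have hn0 : (0 : ℝ) < n := by exact_mod_cast (by omega : 0 < n)
    have h3 : D (ι n) / (p (ι n + 1) : ℝ) ^ γ ≤ D (ι n) / (n : ℝ) ^ γ :=
      div_le_div_of_nonneg_left (hD0 _) (Real.rpow_pos_of_pos hn0 γ)
        (Real.rpow_le_rpow hn0.le (by exact_mod_cast h2.le) (by linarith))
    simp only [Function.comp_apply]
    rw [hlineq n hn0]
    refine (sub_le_sub_right h3 _).trans ?_
    rw [hDeq, ← sub_div]
    exact div_le_div_of_nonneg_right (hv n _ h1 h2.le).1 (by positivity)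
  · filter_upwards [eventually_ge_atTop (p 0)] with n hn
    obtain ⟨h1, h2⟩ := hι n hn
    have hn0 : (0 : ℝ) < n := by exact_mod_cast (by omega : 0 < n)
    have h3 : D (ι n + 1) / (n : ℝ) ^ γ ≤ D (ι n + 1) / (p (ι n) : ℝ) ^ γ :=
      div_le_div_of_nonneg_left (hD0 _) (Real.rpow_pos_of_pos (hpos _) γ)
        (Real.rpow_le_rpow (hpos _).le (by exact_mod_cast h1) (by linarith))
    simp only [Function.comp_apply]
    rw [hlineq n hn0]
    refine le_trans ?_ (add_le_add_left h3 _)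
    rw [hDeq, ← add_div]
    exact div_le_div_of_nonneg_right (hv n _ h1 h2.le).2 (by positivity)

/-! ### Full dimension of the level sets. -/

theorem le_dimH_of_blockSet_subset {p k : ℕ → ℕ} (h : IsBlockScheme p k)
    (hd : Tendsto (fun i => (∑ j ∈ Finset.range (i + 1), (k j + 2) : ℕ) / (p i : ℝ)) atTop (𝓝 0))
    (hp0 : 1 ≤ p 0) {S : Set BinSeq} (hS : ∀ q, 2 ≤ q → blockSet p k q ⊆ S) : 1 ≤ dimH S := by
  classical
  have key : ∀ ε : ℝ, 0 < ε → ε < 1 → ENNReal.ofReal (1 - ε) ≤ dimH S := by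
    intro ε hε hε1
    -- The two residues modulo `q` take density at most `2/q < ε/2`; the other `ε/2` is left for the
    -- blocks, which have density zero.
    obtain ⟨q, hq⟩ := exists_nat_gt (4 / ε)
    have hq2 : 2 ≤ q := by
      have : (2 : ℝ) < q := lt_trans (by rw [lt_div_iff₀ hε]; linarith) hq
      exact_mod_cast this.le
    have hqpos : (0 : ℝ) < q := by exact_mod_cast (by omega : 0 < q)
    obtain ⟨i₁, hi₁⟩ := eventually_atTop.1 (hd.eventually (gt_mem_nhds (half_pos hε)))
    set E : ℕ → ℕ := fun i => ∑ j ∈ Finset.range (i + 1), (k j + 2) with hE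
    have hEmono : Monotone E := fun a b hab =>
      Finset.sum_le_sum_of_subset (Finset.range_mono (by omega))
    have hEle : ∀ i, (E i : ℝ) ≤ ε / 2 * p i + E i₁ := by
      intro i
      rcases Nat.lt_or_ge i i₁ with h1 | h1
      · have : (E i : ℝ) ≤ E i₁ := by exact_mod_cast hEmono h1.le
        have : 0 ≤ ε / 2 * p i := by positivity
        linarith
      · have hpi : (0 : ℝ) < p i := by
          have := h.strictMono.monotone (Nat.zero_le i)
          exact_mod_cast (by omega : 0 < p i)
        have h2 := hi₁ i h1
        rw [div_lt_iff₀ hpi] at h2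
        have : (0 : ℝ) ≤ E i₁ := Nat.cast_nonneg _
        linarith
    refine (le_dimH_of_forced_digits (IsForced p k q) (forcedDigit p k q)
      (C := E i₁ + 2 + p 0) hε1 fun n => ?_).trans (dimH_mono (hS q hq2))
    rcases Nat.lt_or_ge n (p 0) with h1 | h1
    · have h2 : (Nat.count (IsForced p k q) n : ℝ) ≤ p 0 := by
        exact_mod_cast (Nat.count_le (p := IsForced p k q)).trans h1.le
      have : (0 : ℝ) ≤ E i₁ := Nat.cast_nonneg _
      have : 0 ≤ ε * n := by positivity
      linarith
    · obtain ⟨i, h2, h3⟩ := h.strictMono.exists_between_succ h1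
      have h4 : (Nat.count (IsForced p k q) n : ℝ) ≤ E i + ((n / q : ℕ) + 1) * 2 := by
        exact_mod_cast count_isForced_le h h3.le
      have h5 : ((n / q : ℕ) : ℝ) ≤ n / q := Nat.cast_div_le
      have h6 : (n : ℝ) / q ≤ ε / 4 * n := by
        rw [div_le_iff₀ hqpos]
        rw [div_lt_iff₀ hε] at hq
        nlinarith [Nat.cast_nonneg (α := ℝ) n]
      have h7 : ε / 2 * p i ≤ ε / 2 * n := by
        have : (p i : ℝ) ≤ n := by exact_mod_cast h2
        gcongr
      linarith [hEle i, Nat.cast_nonneg (α := ℝ) (p 0)]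
  have hlim : Tendsto (fun n : ℕ => ENNReal.ofReal (1 - 1 / ((n : ℝ) + 2))) atTop (𝓝 1) := by
    rw [← ENNReal.ofReal_one]
    refine ENNReal.tendsto_ofReal ?_
    have h1 : Tendsto (fun n : ℕ => 1 / ((n : ℝ) + 2)) atTop (𝓝 0) :=
      (tendsto_const_nhds.div_atTop (tendsto_atTop_add_const_right _ 2 tendsto_natCast_atTop_atTop))
    simpa using h1.const_sub 1
  refine le_of_tendsto' hlim fun n => key _ (by positivity) ?_
  rw [div_lt_one (by positivity)]
  linarith [Nat.cast_nonneg (α := ℝ) n]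

/-- A single constant serves on both sides. The factor `1/5` is absorbed into the linear term, which
is where `n ≥ 1` enters. -/
theorem neg_log_bounds {P : ℝ} {q n a b : ℕ} (hn : 1 ≤ n)
    (hlow : ((1 / 4) ^ (q + 2)) ^ n * (1 / 2) ^ b * (1 / 5) ≤ P)
    (hup : P ≤ (Real.pi ^ 2) ^ n * (1 / 2) ^ a) :
    a * Real.log 2 - (Real.log (Real.pi ^ 2) + (q + 2) * Real.log 4 + Real.log 5) * n
        ≤ -Real.log P ∧
      -Real.log P ≤ b * Real.log 2
        + (Real.log (Real.pi ^ 2) + (q + 2) * Real.log 4 + Real.log 5) * n := by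
  have hn' : (1 : ℝ) ≤ n := by exact_mod_cast hn
  have hpi := Real.pi_gt_three
  have hpos : 0 < ((1 / 4 : ℝ) ^ (q + 2)) ^ n * (1 / 2) ^ b * (1 / 5) := by positivity
  have h1 := Real.log_le_log hpos hlow
  have h2 := Real.log_le_log (hpos.trans_le hlow) hup
  rw [Real.log_mul (by positivity) (by norm_num), Real.log_mul (by positivity) (by positivity),
    Real.log_pow, Real.log_pow, Real.log_pow, one_div, one_div, one_div, Real.log_inv, Real.log_inv,
    Real.log_inv] at h1
  rw [Real.log_mul (by positivity) (by positivity), Real.log_pow, Real.log_pow _ a, one_div,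
    Real.log_inv] at h2
  have h3 : 0 ≤ Real.log (Real.pi ^ 2) := Real.log_nonneg (by nlinarith)
  have h4 : 0 ≤ ((q : ℝ) + 2) * Real.log 4 :=
    mul_nonneg (by positivity) (Real.log_nonneg (by norm_num))
  have h5 : 0 ≤ Real.log 5 := Real.log_nonneg (by norm_num)
  push_cast at h1
  constructor <;> nlinarith

/-- The identity includes the value `-∞`, which corresponds to a vanishing factor. -/
theorem birkhoffPsi_eq_log_prod (n : ℕ) (x : BinSeq) :
    birkhoffPsi n x
      = ENNReal.log (ENNReal.ofReal (∏ m ∈ Finset.range n, digitWeight (shift^[m] x))) := by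
  unfold birkhoffPsi
  induction n with
  | zero => simp
  | succ n ih =>
    rw [Finset.sum_range_succ, Finset.prod_range_succ, ENNReal.ofReal_mul
      (Finset.prod_nonneg fun m _ => digitWeight_nonneg _), ENNReal.log_mul_add, ih, psi_eq_log]

section
variable {p k : ℕ → ℕ} {q n i : ℕ} {x : BinSeq}

theorem IsBlockScheme.prod_bounds (h : IsBlockScheme p k) (hq : 2 ≤ q) (hx : x ∈ blockSet p k q)
    (h1 : p i ≤ n) (h2 : n ≤ p (i + 1)) :
    ((1 / 4) ^ (q + 2)) ^ n * (1 / 2) ^ blockSum k (i + 1) * (1 / 5)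
        ≤ ∏ m ∈ Finset.range n, digitWeight (shift^[m] x) ∧
      ∏ m ∈ Finset.range n, digitWeight (shift^[m] x)
        ≤ (Real.pi ^ 2) ^ n * (1 / 2) ^ blockSum k i := by
  refine ⟨le_trans ?_ (h.le_prod_digitWeight (fun m _ => h.exists_ne_near hq hx m) h2),
    h.prod_digitWeight_le hx (PiNat.self_mem_cylinder x n) h1⟩
  -- The factor `1/5` is superfluous here; it gives the bounds the same form as those for cylinders,
  -- so that `tendsto_neg_log` covers both.
  exact mul_le_of_le_one_right (by positivity) (by norm_num)

theorem IsBlockScheme.measure_cylinder_bounds (h : IsBlockScheme p k) (hq : 2 ≤ q)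
    (hx : x ∈ blockSet p k q) (h1 : p i ≤ n) (h2 : n ≤ p (i + 1)) :
    ((1 / 4) ^ (q + 2)) ^ n * (1 / 2) ^ blockSum k (i + 1) * (1 / 5)
        ≤ (thueMorseMeasure (PiNat.cylinder x n)).toReal ∧
      (thueMorseMeasure (PiNat.cylinder x n)).toReal
        ≤ (Real.pi ^ 2) ^ n * (1 / 2) ^ blockSum k i := by
  constructor
  · rw [← ENNReal.ofReal_le_iff_le_toReal (measure_ne_top _ _), ENNReal.ofReal_mul (by positivity)]
    -- The digit after the prefix is taken opposite to its last one, so the final run ends at `n`.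
    refine le_thueMorseMeasure_cylinder (i := Fin.rev (x (n - 1))) fun y hy hyn => ?_
    rw [← ENNReal.ofReal_prod_of_nonneg fun m _ => digitWeight_nonneg _]
    exact ENNReal.ofReal_le_ofReal (h.le_prod_digitWeight
      (fun m hm => h.exists_ne_of_mem_cylinder hq hx hy hyn hm) h2)
  · refine ENNReal.toReal_le_of_le_ofReal (by positivity)
      (thueMorseMeasure_cylinder_le fun y hy => ?_)
    rw [← ENNReal.ofReal_prod_of_nonneg fun m _ => digitWeight_nonneg _]
    exact ENNReal.ofReal_le_ofReal (h.prod_digitWeight_le hx hy h1)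

/-- If `P n` obeys the bounds of `IsBlockScheme.prod_bounds`, then `-log (P n)` grows like
`α n ^ γ log 2`. -/
theorem IsBlockScheme.tendsto_neg_log (h : IsBlockScheme p k) {γ α : ℝ} (hγ : 1 < γ)
    (hp0 : 1 ≤ p 0)
    (hD : Tendsto (fun i => (blockSum k i : ℝ) / (p i : ℝ) ^ γ) atTop (𝓝 α))
    (hr : Tendsto (fun i => (p (i + 1) : ℝ) / (p i : ℝ)) atTop (𝓝 1)) {P : ℕ → ℝ}
    (hP : ∀ n i, p i ≤ n → n ≤ p (i + 1) →
      ((1 / 4) ^ (q + 2)) ^ n * (1 / 2) ^ blockSum k (i + 1) * (1 / 5) ≤ P n ∧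
        P n ≤ (Real.pi ^ 2) ^ n * (1 / 2) ^ blockSum k i) :
    Tendsto (fun n : ℕ => -Real.log (P n) / ((n : ℝ) ^ γ * Real.log 2)) atTop (𝓝 α) := by
  refine tendsto_of_blockSum_bounds
    (c := Real.log (Real.pi ^ 2) + (q + 2) * Real.log 4 + Real.log 5) hγ (Real.log_pos one_lt_two) h.strictMono hp0
    (fun i => Nat.cast_nonneg _) hD hr fun n i h1 h2 => ?_
  have h3 := h.strictMono.monotone (Nat.zero_le i)
  exact neg_log_bounds (by omega) (hP n i h1 h2).1 (hP n i h1 h2).2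

end
end

theorem mainTheorem2 (γ : ℝ) (hγ : γ ∈ Set.Ioo (1 : ℝ) 2) (α : ℝ) (hα : 0 ≤ α) :
    dimH {x : BinSeq | Tendsto (fun n : ℕ =>
        ENNReal.log (thueMorseMeasure (PiNat.cylinder x n)) /
          ((-((n : ℝ) ^ γ * Real.log 2) : ℝ) : EReal)) atTop (𝓝 (α : EReal))} = 1 ∧
    dimH {x : BinSeq | Tendsto (fun n : ℕ =>
        -birkhoffPsi n x / (((n : ℝ) ^ γ * Real.log 2 : ℝ) : EReal))
        atTop (𝓝 (α : EReal))} = 1 := by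
  obtain ⟨p, k, h, hp0, hD, hr, hd⟩ := exists_isBlockScheme hγ hα
  refine ⟨le_antisymm (dimH_binSeq_le_one _) (le_dimH_of_blockSet_subset h hd hp0 ?_),
    le_antisymm (dimH_binSeq_le_one _) (le_dimH_of_blockSet_subset h hd hp0 ?_)⟩
  · intro q hq x hx
    have h1 := h.tendsto_neg_log hγ.1 hp0 hD hr (fun n i => h.measure_cylinder_bounds hq hx (i := i))
    refine (EReal.tendsto_coe.2 h1).congr' ?_
    -- From `p 0` on, the lower bound makes the measure positive, so the extended logarithm is the
    -- real one.
    filter_upwards [eventually_ge_atTop (p 0)] with n hn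
    obtain ⟨i, h2, h3⟩ := h.strictMono.exists_between_succ hn
    have h4 : 0 < (thueMorseMeasure (PiNat.cylinder x n)).toReal :=
      lt_of_lt_of_le (by positivity) (h.measure_cylinder_bounds hq hx h2 h3.le).1
    rw [ENNReal.log_pos_real' h4, ← EReal.coe_div, div_neg, neg_div]
  · intro q hq x hx
    have h1 := h.tendsto_neg_log hγ.1 hp0 hD hr (fun n i => h.prod_bounds hq hx (i := i))
    refine (EReal.tendsto_coe.2 h1).congr' ?_
    filter_upwards [eventually_ge_atTop (p 0)] with n hn
    obtain ⟨i, h2, h3⟩ := h.strictMono.exists_between_succ hn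
    have h4 : 0 < ∏ m ∈ Finset.range n, digitWeight (shift^[m] x) :=
      lt_of_lt_of_le (by positivity) (h.prod_bounds hq hx h2 h3.le).1
    rw [birkhoffPsi_eq_log_prod, ENNReal.log_ofReal_of_pos h4, ← EReal.coe_neg, ← EReal.coe_div]
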